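/- **Conventions.** A C*-seminorm on a complex *-algebra is a submultiplicative seminorm $p$ with $p(a^*a)=p(a)^2$. A locally C*-algebra is a complete Hausdorff topological complex *-algebra $A$ (not necessarily unital) whose topology is determined by the set $S(A)$ of its continuous C*-seminorms; $x\in A$ is positive if $x=b^*b$ for some $b\in A$. A Hilbert $A$-module is a complex vector space $E$ that is a compatible right $A$-module, with an $A$-valued inner product that is $\mathbb C$- and $A$-linear in the second variable, satisfies $\langle\xi,\eta\rangle^*=\langle\eta,\xi\rangle$, $\langle\xi,\xi\rangle\ge 0$ and $\langle\xi,\xi\rangle=0\Leftrightarrow\xi=0$, and for which $E$ is complete for the seminorms $\bar p_E(\xi)=p(\langle\xi,\xi\rangle)^{1/2}$, $p\in S(A)$. In particular $A$ is a Hilbert $A$-module with $\langle a,b\rangle=a^*b$. $L_A(E,F)$ is the set of adjointable $A$-module morphisms $E\to F$, with the topology of the seminorms $\tilde p(T)=\sup\{\bar p_F(T\xi):\bar p_E(\xi)\le 1\}$, $p\in S(A)$. Put $M(A)=L_A(A,A)$ (the multiplier algebra of $A$) and $M(E)=L_A(A,E)$, with right action $t\cdot b=t\circ b$ of $M(A)$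 and $M(A)$-valued inner product $\langle s,t\rangle=s^*\circ t$. The strict topology on $M(E)$ is given by the seminorms $t\mapsto \bar p_E(t(a))+p(t^*(\xi))$, $p\in S(A)$, $a\in A$, $\xi\in E$; for $E=A$ this is the strict topology on $M(A)$. For a sequence $(E_n)_n$ of Hilbert $A$-modules, $\bigoplus_n E_n$ is the Hilbert $A$-module of all sequences $(\xi_n)_n$, $\xi_n\in E_n$, such that $\sum_n\langle\xi_n,\xi_n\rangle$ converges in $A$, with coordinatewise operations and $\langle(\xi_n)_n,(\eta_n)_n\rangle=\sum_n\langle\xi_n,\eta_n\rangle$. Two Hilbert modules over the same algebra are unitarily equivalent if there is an adjointable $U$ between them with $U^*U=\mathrm{id}$ and $UU^*=\mathrm{id}$. **Theorem.** Let $A$ be a locally C*-algebra and let $(E_n)_n$ be a sequence of Hilbert $A$-modules (a finite family being completed by zero modules). Let $$\text{str.-}\bigoplus_n M(E_n)=\Big\{(t_n)_n:\ t_n\in M(E_n),\ \sum_n t_n^*\circ t_n \text{ converges strictly in } M(A)\Big\}.$$ Then $M(A)$ is a locally C*-algebra, and $\text{str.-}\bigoplus_n M(E_n)$, with the coordinatewise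 vector space operations, the action $(t_n)_n\cdot b=(t_n\cdot b)_n$ of $M(A)$, and the inner product $$\langle (t_n)_n,(s_n)_n\rangle_{M(A)}=\text{str.-}\lim_{n}\sum_{k=1}^n t_k^*\circ s_k ,$$ is a (well defined) Hilbert $M(A)$-module; in particular it is closed under these operations and these strict limits exist in $M(A)$. Moreover, the Hilbert $M(A)$-modules $\text{str.-}\bigoplus_n M(E_n)$ and $M\big(\bigoplus_n E_n\big)$ are unitarily equivalent. -/

import Mathlib

namespace LocC

open Filter Topology

universe u v

/-- A C*-seminorm on a complex *-algebra. -/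
structure IsCStarSeminorm {A : Type*} [NonUnitalRing A] [StarRing A] [Module ℂ A]
    (p : Seminorm ℂ A) : Prop where
  mul_le : ∀ a b : A, p (a * b) ≤ p a * p b
  star_mul_self : ∀ a : A, p (star a * a) = p a ^ 2

theorem IsCStarSeminorm.star_eq {A : Type*} [NonUnitalRing A] [StarRing A] [Module ℂ A]
    {p : Seminorm ℂ A} (hp : IsCStarSeminorm p) (a : A) : p (star a) = p a := by
  have key : ∀ b : A, p b ≤ p (star b) := fun b => by
    have h1 := hp.star_mul_self b
    have h2 := hp.mul_le (star b) b
    rcases (apply_nonneg p b).eq_or_lt with h | h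
    · rw [← h]; exact apply_nonneg p _
    · nlinarith
  exact le_antisymm (by simpa using key (star a)) (key a)

/-- The set `S(A)` of all continuous C*-seminorms. -/
abbrev CStarSeminorms (A : Type*) [NonUnitalRing A] [StarRing A] [Module ℂ A]
    [TopologicalSpace A] : Type _ :=
  {p : Seminorm ℂ A // IsCStarSeminorm p ∧ Continuous p}

/-- Completeness for the uniform structure given by a family of seminorm functions: every Cauchy
filter converges. -/
def IsCompleteFor {ι X : Type*} [AddCommGroup X] (q : ι → X → ℝ) : Prop :=
  ∀ F : Filter X, F.NeBot →
    (∀ i, ∀ ε > 0, ∃ s ∈ F, ∀ x ∈ s, ∀ y ∈ s, q i (x - y) < ε) →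
    ∃ x, ∀ i, Tendsto (fun y => q i (y - x)) F (𝓝 0)

/-- A locally C*-algebra: a complete Hausdorff topological *-algebra whose topology is determined by
its continuous C*-seminorms. (Continuity of the algebraic operations follows from the fact that
the topology is given by C*-seminorms.) -/
class LocallyCStarAlgebra (A : Type*) [NonUnitalRing A] [StarRing A] [Module ℂ A]
    [IsScalarTower ℂ A A] [SMulCommClass ℂ A A] [StarModule ℂ A] [TopologicalSpace A] : Prop where
  t2 : T2Space A
  withSeminorms : WithSeminorms (fun p : CStarSeminorms A => p.1)
  complete : IsCompleteFor (fun (p : CStarSeminorms A) (a : A) => p.1 a)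

section modules

open MulOpposite

/-- `E` is a right `A`-module compatible with its complex vector space structure, with an `A`-valued
hermitian form that is `ℂ`- and `A`-linear in its second variable. The element `ξ a` is written
`op a • ξ`. -/
class HermitianModule (A E : Type*) [NonUnitalRing A] [StarRing A] [Module ℂ A]
    [AddCommGroup E] [Module ℂ E] [SMul Aᵐᵒᵖ E] [Inner A E] : Prop where
  op_smul_add : ∀ (a : A) (x y : E), op a • (x + y) = op a • x + op a • y
  add_op_smul : ∀ (a b : A) (x : E), op (a + b) • x = op a • x + op b • x
  mul_op_smul : ∀ (a b : A) (x : E), op (a * b) • x = op b • op a • x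
  smul_op_smul : ∀ (z : ℂ) (a : A) (x : E), op (z • a) • x = z • op a • x
  op_smul_smul : ∀ (z : ℂ) (a : A) (x : E), op a • z • x = z • op a • x
  inner_add_right : ∀ x y z : E, inner A x (y + z) = inner A x y + inner A x z
  inner_smul_right : ∀ (z : ℂ) (x y : E), inner A x (z • y) = z • inner A x y
  inner_op_smul_right : ∀ (a : A) (x y : E), inner A x (op a • y) = inner A x y * a
  star_inner : ∀ x y : E, star (inner A x y) = inner A y x

/-- The seminorm `ξ ↦ p(⟨ξ, ξ⟩)^{1/2}` on `E`. -/
noncomputable def modSeminorm {A : Type*} (E : Type*) [NonUnitalRing A] [StarRing A] [Module ℂ A]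
    [TopologicalSpace A] [Inner A E] (p : CStarSeminorms A) (x : E) : ℝ :=
  √(p.1 (inner A x x))

/-- A Hilbert `A`-module. An element of a locally C*-algebra is positive if it is of the
form `b* b`. -/
class IsHilbertModule (A E : Type*) [NonUnitalRing A] [StarRing A] [Module ℂ A]
    [TopologicalSpace A] [AddCommGroup E] [Module ℂ E] [SMul Aᵐᵒᵖ E] [Inner A E] : Prop
    extends HermitianModule A E where
  inner_self_nonneg : ∀ x : E, ∃ b : A, inner A x x = star b * b
  inner_self_eq_zero : ∀ x : E, inner A x x = 0 → x = 0
  complete : IsCompleteFor (modSeminorm (A := A) E)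

namespace HermitianModule

variable {A E : Type*} [NonUnitalRing A] [StarRing A] [Module ℂ A]
    [AddCommGroup E] [Module ℂ E] [SMul Aᵐᵒᵖ E] [Inner A E] [HermitianModule A E]

theorem op_smul_zero (a : A) : op a • (0 : E) = 0 := by
  simpa using op_smul_add a (0 : E) 0

theorem op_smul_neg (a : A) (x : E) : op a • (-x) = -(op a • x) := by
  have := op_smul_add a x (-x)
  rw [add_neg_cancel, op_smul_zero] at this
  exact (neg_eq_of_add_eq_zero_right this.symm).symm

theorem inner_zero_right (x : E) : inner A x (0 : E) = 0 := by
  simpa using inner_add_right (A := A) x 0 0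

theorem inner_neg_right (x y : E) : inner A x (-y) = -inner A x y := by
  have := inner_add_right (A := A) x y (-y)
  rw [add_neg_cancel, inner_zero_right] at this
  exact (neg_eq_of_add_eq_zero_right this.symm).symm

theorem inner_add_left (x y z : E) : inner A (x + y) z = inner A x z + inner A y z := by
  rw [← star_inner z, inner_add_right, star_add, star_inner, star_inner]

theorem inner_zero_left (x : E) : inner A (0 : E) x = 0 := by
  rw [← star_inner, inner_zero_right, star_zero]

theorem inner_neg_left (x y : E) : inner A (-x) y = -inner A x y := by
  rw [← star_inner, inner_neg_right, star_neg, star_inner]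

theorem inner_smul_left [StarModule ℂ A] (z : ℂ) (x y : E) :
    inner A (z • x) y = star z • inner A x y := by
  rw [← star_inner, inner_smul_right, star_smul, star_inner]

theorem inner_op_smul_left (a : A) (x y : E) :
    inner A (op a • x) y = star a * inner A x y := by
  rw [← star_inner, inner_op_smul_right, star_mul, star_inner]

end HermitianModule

/-- The `A`-valued inner product `⟨a, b⟩ = a* b` of a *-algebra `A`. -/
instance (priority := 50) selfInner (A : Type*) [NonUnitalRing A] [StarRing A] : Inner A A :=
  ⟨fun a b => star a * b⟩

theorem selfInner_def {A : Type*} [NonUnitalRing A] [StarRing A] (a b : A) :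
    inner A a b = star a * b := rfl

instance selfHermitianModule (A : Type*) [NonUnitalRing A] [StarRing A] [Module ℂ A]
    [IsScalarTower ℂ A A] [SMulCommClass ℂ A A] : HermitianModule A A where
  op_smul_add a x y := add_mul x y a
  add_op_smul a b x := mul_add x a b
  mul_op_smul a b x := (mul_assoc x a b).symm
  smul_op_smul z a x := mul_smul_comm z x a
  op_smul_smul z a x := smul_mul_assoc z x a
  inner_add_right x y z := mul_add _ _ _
  inner_smul_right z x y := mul_smul_comm z _ _
  inner_op_smul_right a x y := (mul_assoc (star x) y a).symm
  star_inner x y := by rw [selfInner_def, selfInner_def, star_mul, star_star]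

end modules

section adjointable

open MulOpposite HermitianModule

/-- An adjointable `A`-module morphism `E → F`, together with its adjoint `F → E`. (When the
inner products are definite, the adjoint is determined by the morphism.) -/
structure Adjointable (A E F : Type*) [AddCommGroup E] [Module ℂ E] [SMul Aᵐᵒᵖ E] [Inner A E]
    [AddCommGroup F] [Module ℂ F] [SMul Aᵐᵒᵖ F] [Inner A F] where
  /-- the morphism -/
  toLin : E →ₗ[ℂ] F
  /-- its adjoint -/
  adj : F →ₗ[ℂ] E
  map_op_smul : ∀ (a : A) (x : E), toLin (op a • x) = op a • toLin x
  adj_op_smul : ∀ (a : A) (y : F), adj (op a • y) = op a • adj y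
  inner_eq : ∀ (x : E) (y : F), inner A (toLin x) y = inner A x (adj y)

namespace Adjointable

section basic
variable {A E F G : Type*} [AddCommGroup E] [Module ℂ E] [SMul Aᵐᵒᵖ E] [Inner A E]
  [AddCommGroup F] [Module ℂ F] [SMul Aᵐᵒᵖ F] [Inner A F]
  [AddCommGroup G] [Module ℂ G] [SMul Aᵐᵒᵖ G] [Inner A G]

theorem ext' {T S : Adjointable A E F} (h : ∀ x, T.toLin x = S.toLin x)
    (h' : ∀ y, T.adj y = S.adj y) : T = S := by
  cases T; cases S
  obtain rfl := LinearMap.ext h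
  obtain rfl := LinearMap.ext h'
  rfl

variable (A E) in
/-- The identity operator. -/
def id : Adjointable A E E :=
  ⟨LinearMap.id, LinearMap.id, fun _ _ => rfl, fun _ _ => rfl, fun _ _ => rfl⟩

/-- Composition; `(T ∘ S)* = S* ∘ T*`. -/
def comp (T : Adjointable A F G) (S : Adjointable A E F) : Adjointable A E G where
  toLin := T.toLin ∘ₗ S.toLin
  adj := S.adj ∘ₗ T.adj
  map_op_smul a x := by simp [S.map_op_smul, T.map_op_smul]
  adj_op_smul a x := by simp [S.adj_op_smul, T.adj_op_smul]
  inner_eq x y := by simp [S.inner_eq, T.inner_eq]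

end basic

variable {A E F : Type*} [NonUnitalRing A] [StarRing A] [Module ℂ A]
  [AddCommGroup E] [Module ℂ E] [SMul Aᵐᵒᵖ E] [Inner A E] [HermitianModule A E]
  [AddCommGroup F] [Module ℂ F] [SMul Aᵐᵒᵖ F] [Inner A F] [HermitianModule A F]

/-- The adjoint `T* : F → E` of `T : E → F`. -/
def adjoint (T : Adjointable A E F) : Adjointable A F E where
  toLin := T.adj
  adj := T.toLin
  map_op_smul := T.adj_op_smul
  adj_op_smul := T.map_op_smul
  inner_eq x y := by rw [← star_inner, ← T.inner_eq, star_inner]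

instance : Zero (Adjointable A E F) :=
  ⟨⟨0, 0, fun a _ => by simp [op_smul_zero a], fun a _ => by simp [op_smul_zero a],
    fun x y => by simp [HermitianModule.inner_zero_left, HermitianModule.inner_zero_right]⟩⟩

instance : Add (Adjointable A E F) :=
  ⟨fun T S => ⟨T.toLin + S.toLin, T.adj + S.adj,
    fun a x => by simp [T.map_op_smul, S.map_op_smul, op_smul_add],
    fun a x => by simp [T.adj_op_smul, S.adj_op_smul, op_smul_add],
    fun x y => by
      simp [HermitianModule.inner_add_left, HermitianModule.inner_add_right, T.inner_eq, S.inner_eq]⟩⟩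

instance : Neg (Adjointable A E F) :=
  ⟨fun T => ⟨-T.toLin, -T.adj,
    fun a x => by simp [T.map_op_smul, op_smul_neg],
    fun a x => by simp [T.adj_op_smul, op_smul_neg],
    fun x y => by simp [HermitianModule.inner_neg_left, HermitianModule.inner_neg_right, T.inner_eq]⟩⟩

instance [StarModule ℂ A] : SMul ℂ (Adjointable A E F) :=
  ⟨fun z T => ⟨z • T.toLin, star z • T.adj,
    fun a x => by simp [T.map_op_smul, op_smul_smul],
    fun a x => by simp [T.adj_op_smul, op_smul_smul],
    fun x y => by
      rw [LinearMap.smul_apply, LinearMap.smul_apply, HermitianModule.inner_smul_left,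
        HermitianModule.inner_smul_right, T.inner_eq]⟩⟩

instance : AddCommGroup (Adjointable A E F) where
  add_assoc T S R := ext' (fun _ => add_assoc _ _ _) (fun _ => add_assoc _ _ _)
  zero_add T := ext' (fun _ => zero_add _) (fun _ => zero_add _)
  add_zero T := ext' (fun _ => add_zero _) (fun _ => add_zero _)
  neg_add_cancel T := ext' (fun _ => neg_add_cancel _) (fun _ => neg_add_cancel _)
  add_comm T S := ext' (fun _ => add_comm _ _) (fun _ => add_comm _ _)
  nsmul := nsmulRec
  zsmul := zsmulRec

instance [StarModule ℂ A] : Module ℂ (Adjointable A E F) where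
  one_smul T := ext' (fun _ => one_smul _ _) (fun x => by
    change star (1 : ℂ) • T.adj x = T.adj x
    rw [star_one, one_smul])
  mul_smul z w T := ext' (fun _ => mul_smul _ _ _) (fun x => by
    change star (z * w) • T.adj x = star z • star w • T.adj x
    rw [star_mul', mul_smul])
  smul_zero z := ext' (fun _ => smul_zero _) (fun _ => smul_zero _)
  smul_add z T S := ext' (fun _ => smul_add _ _ _) (fun _ => smul_add _ _ _)
  add_smul z w T := ext' (fun _ => add_smul _ _ _) (fun x => by
    change star (z + w) • T.adj x = star z • T.adj x + star w • T.adj x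
    rw [star_add, add_smul])
  zero_smul T := ext' (fun _ => zero_smul _ _) (fun x => by
    change star (0 : ℂ) • T.adj x = 0
    rw [star_zero, zero_smul])

/-- The algebra `L_A(E)`, with composition as multiplication. -/
instance : NonUnitalRing (Adjointable A E E) where
  mul := comp
  left_distrib T _ _ := ext' (fun _ => map_add T.toLin _ _) (fun _ => rfl)
  right_distrib _ _ R := ext' (fun _ => rfl) (fun _ => map_add R.adj _ _)
  zero_mul T := ext' (fun _ => rfl) (fun _ => map_zero T.adj)
  mul_zero T := ext' (fun _ => map_zero T.toLin) (fun _ => rfl)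
  mul_assoc _ _ _ := rfl

instance : StarRing (Adjointable A E E) where
  star := adjoint
  star_involutive _ := rfl
  star_mul _ _ := rfl
  star_add _ _ := rfl

instance [StarModule ℂ A] : IsScalarTower ℂ (Adjointable A E E) (Adjointable A E E) :=
  ⟨fun _ _ S => ext' (fun _ => rfl) (fun _ => map_smul S.adj _ _)⟩

instance [StarModule ℂ A] : SMulCommClass ℂ (Adjointable A E E) (Adjointable A E E) :=
  ⟨fun _ T _ => ext' (fun _ => (map_smul T.toLin _ _).symm) (fun _ => rfl)⟩

instance [StarModule ℂ A] : StarModule ℂ (Adjointable A E E) :=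
  ⟨fun z T => ext' (fun _ => rfl) (fun x => by
    change z • T.toLin x = star (star z) • T.toLin x
    rw [star_star])⟩

variable [TopologicalSpace A]

/-- `p̃(T) = sup {p̄_F(T ξ) : p̄_E(ξ) ≤ 1}`, the norm of the operator induced by `T` from `E_p`
to `F_p` (as an extended real, so that no finiteness is presupposed). -/
noncomputable def opSeminorm (p : CStarSeminorms A) (T : Adjointable A E F) : ENNReal :=
  ⨆ (x : E) (_ : modSeminorm E p x ≤ 1), ENNReal.ofReal (modSeminorm F p (T.toLin x))

/-- The topology on `L_A(E, F)` determined by the seminorms `p̃`. -/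
instance : TopologicalSpace (Adjointable A E F) :=
  TopologicalSpace.generateFrom
    {U | ∃ (p : CStarSeminorms A) (T₀ : Adjointable A E F) (ε : ENNReal), 0 < ε ∧
      U = {T | opSeminorm p (T - T₀) < ε}}

end Adjointable

/-- Two Hilbert `A`-modules are unitarily equivalent if there is a unitary in `L_A(E, F)`. -/
def UnitarilyEquivalent (A E F : Type*) [AddCommGroup E] [Module ℂ E] [SMul Aᵐᵒᵖ E] [Inner A E]
    [AddCommGroup F] [Module ℂ F] [SMul Aᵐᵒᵖ F] [Inner A F] : Prop :=
  ∃ U : Adjointable A E F, (∀ x, U.adj (U.toLin x) = x) ∧ (∀ y, U.toLin (U.adj y) = y)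

end adjointable

section multiplier

open MulOpposite HermitianModule

variable (A : Type u) [NonUnitalRing A] [StarRing A] [Module ℂ A] [IsScalarTower ℂ A A]
  [SMulCommClass ℂ A A] [StarModule ℂ A]

/-- The multiplier algebra `M(A) = L_A(A)`. -/
abbrev MultiplierAlg : Type u := Adjointable A A A

/-- The multiplier module `M(E) = L_A(A, E)`. -/
abbrev MultiplierModule (E : Type v) [AddCommGroup E] [Module ℂ E] [SMul Aᵐᵒᵖ E] [Inner A E] :
    Type (max u v) := Adjointable A A E

variable {A} {E : Type v} [AddCommGroup E] [Module ℂ E] [SMul Aᵐᵒᵖ E] [Inner A E]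

/-- The right action `t · m = t ∘ m` of `M(A)` on `M(E)`. -/
instance : SMul (MultiplierAlg A)ᵐᵒᵖ (MultiplierModule A E) :=
  ⟨fun m t => t.comp m.unop⟩

variable [HermitianModule A E]

/-- The `M(A)`-valued inner product `⟨s, t⟩ = s* ∘ t` on `M(E)`. -/
instance : Inner (MultiplierAlg A) (MultiplierModule A E) :=
  ⟨fun s t => s.adjoint.comp t⟩

variable [TopologicalSpace A]

/-- The seminorms `‖t‖_{p,a,ξ} = p̄(t a) + p(t* ξ)` generating the strict topology of `M(E)`. -/
noncomputable def strictSeminorm (p : CStarSeminorms A) (a : A) (ξ : E)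
    (t : MultiplierModule A E) : ℝ :=
  modSeminorm E p (t.toLin a) + p.1 (t.adj ξ)

/-- Convergence in the strict topology of `M(E)`. -/
def StrictTendsto {ι : Type*} (f : ι → MultiplierModule A E) (l : Filter ι)
    (t : MultiplierModule A E) : Prop :=
  ∀ (p : CStarSeminorms A) (a : A) (ξ : E),
    Tendsto (fun i => strictSeminorm p a ξ (f i - t)) l (𝓝 0)

end multiplier

section completion

variable {A : Type u} [NonUnitalRing A] [StarRing A] [Module ℂ A] [IsScalarTower ℂ A A]
  [SMulCommClass ℂ A A] [StarModule ℂ A]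

/-- A copy of the algebra, to carry one C*-seminorm. -/
def Semi (_p : Seminorm ℂ A) : Type u := A

set_option maxHeartbeats 1000000 in
open UniformSpace in
/-- A C*-seminorm is the pullback of the norm of a C*-algebra along a *-homomorphism. -/
theorem IsCStarSeminorm.exists_hom {p : Seminorm ℂ A} (hp : IsCStarSeminorm p) :
    ∃ (B : Type u) (_ : NonUnitalCStarAlgebra B) (f : A →⋆ₙₐ[ℂ] B), ∀ a, ‖f a‖ = p a := by
  let iR : NonUnitalRing (Semi p) := inferInstanceAs (NonUnitalRing A)
  let iS : StarRing (Semi p) := inferInstanceAs (StarRing A)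
  let iM : Module ℂ (Semi p) := inferInstanceAs (Module ℂ A)
  have : IsScalarTower ℂ (Semi p) (Semi p) := inferInstanceAs (IsScalarTower ℂ A A)
  have : SMulCommClass ℂ (Semi p) (Semi p) := inferInstanceAs (SMulCommClass ℂ A A)
  have : StarModule ℂ (Semi p) := inferInstanceAs (StarModule ℂ A)
  let q : Seminorm ℂ (Semi p) := p
  have hq : IsCStarSeminorm q := hp
  let iN : SeminormedAddCommGroup (Semi p) := q.toSeminormedAddCommGroup
  have hn : ∀ a : Semi p, ‖a‖ = q a := fun _ => rfl
  let : NonUnitalSeminormedRing (Semi p) :=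
    { iN, iR with norm_mul_le := fun a b => hq.mul_le a b }
  let : NormedSpace ℂ (Semi p) := { iM with norm_smul_le := fun c a => (map_smul_eq_mul q c a).le }
  have hstar : ∀ a : Semi p, ‖star a‖ = ‖a‖ := fun a => hq.star_eq a
  let B := Completion (Semi p)
  let : Mul B := ⟨Function.curry <|
    (Completion.isDenseInducing_coe.prodMap Completion.isDenseInducing_coe).extend
      ((↑) ∘ Function.uncurry (· * ·))⟩
  have coe_mul : ∀ a b : Semi p, ((a * b : Semi p) : B) = a * b := fun a b =>
    ((Completion.isDenseInducing_coe.prodMap Completion.isDenseInducing_coe).extend_eq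
      ((Completion.continuous_coe (Semi p)).comp (@continuous_mul (Semi p) _ _ _)) (a, b)).symm
  have : ContinuousMul B := ⟨by
    let m := (AddMonoidHom.mul : Semi p →+ Semi p →+ Semi p).compr₂ Completion.toCompl
    have : Continuous fun p : Semi p × Semi p => m p.1 p.2 :=
      (Completion.continuous_coe (Semi p)).comp continuous_mul
    have di : IsDenseInducing (Completion.toCompl : Semi p → B) := Completion.isDenseInducing_coe
    exact (di.extend_Z_bilin di this :)⟩
  have sl : LipschitzWith 1 (star : Semi p → Semi p) := LipschitzWith.of_dist_le_mul fun a b => by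
    rw [dist_eq_norm, dist_eq_norm, ← star_sub, hstar]; simp
  let : Star B := ⟨Completion.map star⟩
  have coe_star : ∀ a : Semi p, ((star a : Semi p) : B) = star (a : B) := fun a =>
    (Completion.map_coe sl.uniformContinuous a).symm
  have cstar : Continuous (star : B → B) := Completion.continuous_map
  have : ContinuousStar B := ⟨cstar⟩
  let iB : NonUnitalRing B :=
    { (inferInstance : AddCommGroup B), (inferInstance : Mul B) with
      zero_mul a := Completion.induction_on a (isClosed_eq (by fun_prop) continuous_const)
        fun a => by rw [← Completion.coe_zero, ← coe_mul, zero_mul]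
      mul_zero a := Completion.induction_on a (isClosed_eq (by fun_prop) continuous_const)
        fun a => by rw [← Completion.coe_zero, ← coe_mul, mul_zero]
      mul_assoc a b c := Completion.induction_on₃ a b c (isClosed_eq (by fun_prop) (by fun_prop))
        fun a b c => by rw [← coe_mul, ← coe_mul, ← coe_mul, ← coe_mul, mul_assoc]
      left_distrib a b c :=
        Completion.induction_on₃ a b c (isClosed_eq (by fun_prop) (by fun_prop))
          fun a b c => by
            rw [← Completion.coe_add, ← coe_mul, ← coe_mul, ← coe_mul, ← Completion.coe_add,
              mul_add]
      right_distrib a b c :=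
        Completion.induction_on₃ a b c (isClosed_eq (by fun_prop) (by fun_prop))
          fun a b c => by
            rw [← Completion.coe_add, ← coe_mul, ← coe_mul, ← coe_mul, ← Completion.coe_add,
              add_mul] }
  let iNB : NonUnitalNormedRing B :=
    { (inferInstance : NormedAddCommGroup B), iB with
      norm_mul_le := fun x y => by
        refine Completion.induction_on₂ x y (isClosed_le (by fun_prop) (by fun_prop)) ?_
        intro x y
        rw [← coe_mul, Completion.norm_coe, Completion.norm_coe, Completion.norm_coe]
        exact norm_mul_le x y }
  let iSB : StarRing B :=
    { star_involutive := fun x => Completion.induction_on x (isClosed_eq (by fun_prop) (by fun_prop))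
        fun a => by rw [← coe_star, ← coe_star, star_star]
      star_mul := fun x y => Completion.induction_on₂ x y
        (isClosed_eq (by fun_prop) (by fun_prop))
        fun a b => by rw [← coe_mul, ← coe_star, ← coe_star, ← coe_star, ← coe_mul, star_mul]
      star_add := fun x y => Completion.induction_on₂ x y
        (isClosed_eq (by fun_prop) (by fun_prop))
        fun a b => by
          rw [← Completion.coe_add, ← coe_star, ← coe_star, ← coe_star, ← Completion.coe_add,
            star_add] }
  have hT : IsScalarTower ℂ B B := ⟨fun c x y => Completion.induction_on₂ x y
    (isClosed_eq (((continuous_fst.const_smul c).mul continuous_snd))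
      ((continuous_fst.mul continuous_snd).const_smul c)) fun a b => by
      change (c • (a : B)) * (b : B) = c • ((a : B) * (b : B))
      rw [← Completion.coe_smul, ← coe_mul, ← coe_mul, ← Completion.coe_smul, smul_mul_assoc]⟩
  have hC : SMulCommClass ℂ B B := ⟨fun c x y => Completion.induction_on₂ x y
    (isClosed_eq ((continuous_fst.mul continuous_snd).const_smul c)
      (continuous_fst.mul (continuous_snd.const_smul c))) fun a b => by
      change c • ((a : B) * (b : B)) = (a : B) * (c • (b : B))
      rw [← Completion.coe_smul, ← coe_mul, ← coe_mul, ← Completion.coe_smul, mul_smul_comm]⟩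
  have hS : StarModule ℂ B := ⟨fun c x => Completion.induction_on x
    (isClosed_eq (cstar.comp (continuous_id.const_smul c)) (cstar.const_smul (star c)))
    fun a => by
      change star (c • (a : B)) = star c • star (a : B)
      rw [← Completion.coe_smul, ← coe_star, ← coe_star, ← Completion.coe_smul, star_smul]⟩
  let iC : NonUnitalCStarAlgebra B :=
    { iNB, iSB, (inferInstance : NormedSpace ℂ B), (inferInstance : CompleteSpace B) with
      norm_mul_self_le := fun x => Completion.induction_on x
        (isClosed_le (by fun_prop) (by fun_prop)) fun a => by
          rw [← coe_star, ← coe_mul, Completion.norm_coe, Completion.norm_coe, hn, hn,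
            hq.star_mul_self, sq]
      smul_assoc := hT.smul_assoc
      smul_comm := hC.smul_comm
      star_smul := hS.star_smul }
  let f : Semi p →⋆ₙₐ[ℂ] B :=
    { toFun := fun a => (a : B)
      map_smul' := fun c a => Completion.coe_smul c a
      map_zero' := Completion.coe_zero
      map_add' := fun a b => Completion.coe_add a b
      map_mul' := coe_mul
      map_star' := coe_star }
  exact ⟨B, iC, f, fun a => Completion.norm_coe (E := Semi p) a⟩
end completion

section hilbertSum

open MulOpposite

variable {A : Type u} [NonUnitalRing A] [StarRing A] [Module ℂ A] [IsScalarTower ℂ A A]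
  [SMulCommClass ℂ A A] [StarModule ℂ A] [TopologicalSpace A]
  {E : ℕ → Type v} [∀ n, AddCommGroup (E n)] [∀ n, Module ℂ (E n)] [∀ n, SMul Aᵐᵒᵖ (E n)]
  [∀ n, Inner A (E n)]

/-- The Cauchy-Schwarz inequality for finite families. -/
theorem cauchySchwarz [∀ n, IsHilbertModule A (E n)] {p : Seminorm ℂ A} (hp : IsCStarSeminorm p)
    (s : Finset ℕ) (x y : ∀ n, E n) :
    p (∑ k ∈ s, inner A (x k) (y k)) ^ 2 ≤
      p (∑ k ∈ s, inner A (x k) (x k)) * p (∑ k ∈ s, inner A (y k) (y k)) := by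
  obtain ⟨B, _, f, hf⟩ := hp.exists_hom
  let _ : PartialOrder B := CStarAlgebra.spectralOrder B
  have _ : StarOrderedRing B := CStarAlgebra.spectralOrderedRing B
  set a := ∑ k ∈ s, inner A (x k) (x k) with ha
  set b := ∑ k ∈ s, inner A (y k) (y k) with hb
  set c := ∑ k ∈ s, inner A (x k) (y k) with hc
  have hc' : star c = ∑ k ∈ s, inner A (y k) (x k) := by
    rw [hc, star_sum]; exact Finset.sum_congr rfl fun k _ => HermitianModule.star_inner _ _
  have pos : ∀ n (z : E n), 0 ≤ f (inner A z z) := fun n z => by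
    obtain ⟨d, hd⟩ := IsHilbertModule.inner_self_nonneg (A := A) z
    rw [hd, map_mul, map_star]; exact star_mul_self_nonneg _
  have key : ∀ κ : ℝ, p a < κ → p c ^ 2 ≤ κ * p b := by
    intro κ hκ
    have hκ0 : 0 < κ := (apply_nonneg p a).trans_lt hκ
    have e1 : ∀ k, inner A (op c • x k - (κ : ℂ) • y k) (op c • x k - (κ : ℂ) • y k) =
        star c * inner A (x k) (x k) * c - (κ : ℂ) • (star c * inner A (x k) (y k))
          - (κ : ℂ) • (inner A (y k) (x k) * c) + (κ : ℂ) • (κ : ℂ) • inner A (y k) (y k) := by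
      intro k
      have hk : star (κ : ℂ) = κ := Complex.conj_ofReal κ
      simp only [sub_eq_add_neg, HermitianModule.inner_add_left, HermitianModule.inner_add_right,
        HermitianModule.inner_neg_left, HermitianModule.inner_neg_right,
        HermitianModule.inner_smul_left, HermitianModule.inner_smul_right, hk,
        HermitianModule.inner_op_smul_left, HermitianModule.inner_op_smul_right, add_mul, neg_mul,
        smul_add, smul_neg, smul_mul_assoc]
      abel
    have e2 : ∑ k ∈ s, inner A (op c • x k - (κ : ℂ) • y k) (op c • x k - (κ : ℂ) • y k) =
        star c * a * c - (κ : ℂ) • (star c * c) - (κ : ℂ) • (star c * c)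
          + (κ : ℂ) • (κ : ℂ) • b := by
      rw [Finset.sum_congr rfl fun k _ => e1 k, Finset.sum_add_distrib, Finset.sum_sub_distrib,
        Finset.sum_sub_distrib, ← Finset.smul_sum, ← Finset.smul_sum, ← Finset.smul_sum,
        ← Finset.smul_sum, ← Finset.sum_mul, ← Finset.sum_mul, ← Finset.mul_sum, ← Finset.mul_sum,
        ← hc']
    have h0 : 0 ≤ f (star c * a * c - (κ : ℂ) • (star c * c) - (κ : ℂ) • (star c * c)
          + (κ : ℂ) • (κ : ℂ) • b) := by
      rw [← e2, map_sum]
      exact Finset.sum_nonneg fun k _ => pos k _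
    have sm : ∀ z : B, (κ : ℂ) • z = κ • z := fun z => Complex.coe_smul κ z
    simp only [map_add, map_sub, map_mul, map_star, map_smul, sm] at h0
    have haS : IsSelfAdjoint (f a) := by
      have : star a = a := by
        rw [ha, star_sum]; exact Finset.sum_congr rfl fun k _ => HermitianModule.star_inner _ _
      rw [IsSelfAdjoint, ← map_star, this]
    have h1 : star (f c) * f a * f c ≤ ‖f a‖ • (star (f c) * f c) :=
      CStarAlgebra.star_left_conjugate_le_norm_smul (hb := haS)
    have h2 : ‖f a‖ • (star (f c) * f c) ≤ κ • (star (f c) * f c) :=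
      smul_le_smul_of_nonneg_right (by rw [hf]; exact hκ.le) (star_mul_self_nonneg _)
    have h3 : κ • (star (f c) * f c) ≤ κ • (κ • f b) := by
      have h4 := h1.trans h2
      have h5 : 0 ≤ κ • (star (f c) * f c) - κ • (star (f c) * f c) - κ • (star (f c) * f c)
          + κ • κ • f b := h0.trans (by gcongr)
      rw [sub_self, zero_sub] at h5
      rwa [neg_add_eq_sub, sub_nonneg] at h5
    have h6 : star (f c) * f c ≤ κ • f b := (smul_le_smul_iff_of_pos_left hκ0).mp h3
    have h7 := CStarAlgebra.norm_le_norm_of_nonneg_of_le (star_mul_self_nonneg _) h6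
    rw [CStarRing.norm_star_mul_self, norm_smul, hf, hf, Real.norm_of_nonneg hκ0.le] at h7
    rwa [sq]
  have lim : Tendsto (fun κ : ℝ => κ * p b) (𝓝[>] (p a)) (𝓝 (p a * p b)) :=
    ((continuous_id.mul continuous_const).tendsto _).mono_left nhdsWithin_le_nhds
  exact ge_of_tendsto lim (by filter_upwards [self_mem_nhdsWithin] with κ hκ using key κ hκ)

variable [LocallyCStarAlgebra A]

theorem tendsto_iff_seminorm {u : ℕ → A} {l : A} :
    Tendsto u atTop (𝓝 l) ↔ ∀ p : CStarSeminorms A, ∀ ε > 0, ∀ᶠ n in atTop, p.1 (u n - l) < ε :=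
  (LocallyCStarAlgebra.withSeminorms (A := A)).tendsto_nhds u l

/-- The Cauchy criterion for series in `A`. -/
theorem tendsto_of_cauchy {w : ℕ → A}
    (h : ∀ p : CStarSeminorms A, ∀ ε > 0, ∃ N, ∀ n ≥ N, ∀ m ≥ n,
      p.1 (∑ k ∈ Finset.Ico n m, w k) < ε) :
    ∃ l, Tendsto (fun n => ∑ k ∈ Finset.range n, w k) atTop (𝓝 l) := by
  set u := fun n => ∑ k ∈ Finset.range n, w k with hu
  have hd : ∀ n m, n ≤ m → u m - u n = ∑ k ∈ Finset.Ico n m, w k := fun n m hnm =>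
    (Finset.sum_Ico_eq_sub w hnm).symm
  obtain ⟨l, hl⟩ := LocallyCStarAlgebra.complete (A := A) (map u atTop) inferInstance (by
    intro p ε hε
    obtain ⟨N, hN⟩ := h p ε hε
    refine ⟨u '' Set.Ici N, image_mem_map (mem_atTop N), ?_⟩
    rintro _ ⟨n, hn, rfl⟩ _ ⟨m, hm, rfl⟩
    change p.1 (u n - u m) < ε
    rcases le_total n m with h' | h'
    · rw [map_sub_rev, hd n m h']; exact hN n hn m h'
    · rw [hd m n h']; exact hN m hm n h')
  refine ⟨l, tendsto_iff_seminorm.2 fun p ε hε => ?_⟩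
  exact (hl p).eventually (gt_mem_nhds hε)

theorem cauchy_of_tendsto {w : ℕ → A} {l : A}
    (h : Tendsto (fun n => ∑ k ∈ Finset.range n, w k) atTop (𝓝 l))
    (p : CStarSeminorms A) (ε : ℝ) (hε : 0 < ε) :
    ∃ N, ∀ n ≥ N, ∀ m ≥ n, p.1 (∑ k ∈ Finset.Ico n m, w k) < ε := by
  obtain ⟨N, hN⟩ := eventually_atTop.1 (tendsto_iff_seminorm.1 h p (ε / 2) (half_pos hε))
  refine ⟨N, fun n hn m hm => ?_⟩
  rw [Finset.sum_Ico_eq_sub w hm, ← sub_sub_sub_cancel_right _ _ l]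
  have := map_sub_le_add p.1 (∑ k ∈ Finset.range m, w k - l) (∑ k ∈ Finset.range n, w k - l)
  linarith [hN n hn, hN m (hn.trans hm)]

/-- `Σ ⟨ξ_n, ξ_n⟩` converges in `A`. -/
def SquareSummable (A : Type u) [NonUnitalRing A] [TopologicalSpace A]
    {E : ℕ → Type v} [∀ n, Inner A (E n)] (ξ : ∀ n, E n) : Prop :=
  ∃ l : A, Tendsto (fun n => ∑ k ∈ Finset.range n, inner A (ξ k) (ξ k)) atTop (𝓝 l)

variable [∀ n, IsHilbertModule A (E n)]

/-- If `Σ ⟨ξ_n, ξ_n⟩` and `Σ ⟨η_n, η_n⟩` converge then so does `Σ ⟨ξ_n, η_n⟩`. -/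
theorem SquareSummable.inner_tendsto {ξ η : ∀ n, E n} (hξ : SquareSummable A ξ)
    (hη : SquareSummable A η) :
    ∃ l : A, Tendsto (fun n => ∑ k ∈ Finset.range n, inner A (ξ k) (η k)) atTop (𝓝 l) := by
  obtain ⟨a, ha⟩ := hξ
  obtain ⟨b, hb⟩ := hη
  refine tendsto_of_cauchy fun p ε hε => ?_
  obtain ⟨N, hN⟩ := cauchy_of_tendsto ha p ε hε
  obtain ⟨M, hM⟩ := cauchy_of_tendsto hb p ε hε
  refine ⟨max N M, fun n hn m hm => ?_⟩
  have h1 := hN n (le_of_max_le_left hn) m hm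
  have h2 := hM n (le_of_max_le_right hn) m hm
  have h3 := cauchySchwarz p.2.1 (Finset.Ico n m) ξ η
  refine lt_of_pow_lt_pow_left₀ 2 hε.le (h3.trans_lt ?_)
  rw [sq]
  exact mul_lt_mul'' h1 h2 (apply_nonneg _ _) (apply_nonneg _ _)

/-- The square summable sequences form a subspace. -/
def squareSummable (A : Type u) [NonUnitalRing A] [StarRing A] [Module ℂ A] [IsScalarTower ℂ A A]
    [SMulCommClass ℂ A A] [StarModule ℂ A] [TopologicalSpace A] [LocallyCStarAlgebra A]
    (E : ℕ → Type v) [∀ n, AddCommGroup (E n)] [∀ n, Module ℂ (E n)] [∀ n, SMul Aᵐᵒᵖ (E n)]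
    [∀ n, Inner A (E n)] [∀ n, IsHilbertModule A (E n)] : Submodule ℂ (∀ n, E n) where
  carrier := {ξ | SquareSummable A ξ}
  zero_mem' := ⟨0, by simpa [HermitianModule.inner_zero_right] using tendsto_const_nhds⟩
  add_mem' := by
    intro ξ η hξ hη
    have _ : IsTopologicalAddGroup A := LocallyCStarAlgebra.withSeminorms.topologicalAddGroup
    obtain ⟨a, ha⟩ := id hξ
    obtain ⟨b, hb⟩ := id hη
    obtain ⟨c, hc⟩ := hξ.inner_tendsto hη
    obtain ⟨d, hd⟩ := hη.inner_tendsto hξ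
    refine ⟨(a + d) + (c + b), ((ha.add hd).add (hc.add hb)).congr fun n => ?_⟩
    simp only [← Finset.sum_add_distrib]
    refine Finset.sum_congr rfl fun k _ => ?_
    rw [Pi.add_apply, HermitianModule.inner_add_right, HermitianModule.inner_add_left,
      HermitianModule.inner_add_left]
  smul_mem' := by
    rintro z ξ ⟨a, ha⟩
    have _ : ContinuousSMul ℂ A := LocallyCStarAlgebra.withSeminorms.continuousSMul
    refine ⟨z • star z • a, ((ha.const_smul (star z)).const_smul z).congr fun n => ?_⟩
    simp only [Finset.smul_sum]
    refine Finset.sum_congr rfl fun k _ => ?_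
    rw [Pi.smul_apply, HermitianModule.inner_smul_right, HermitianModule.inner_smul_left]

/-- The direct sum `⨁ E_n` of a sequence of Hilbert `A`-modules: all sequences `(ξ_n)` for
which `Σ ⟨ξ_n, ξ_n⟩` converges in `A`. -/
abbrev HilbertSum (A : Type u) [NonUnitalRing A] [StarRing A] [Module ℂ A] [IsScalarTower ℂ A A]
    [SMulCommClass ℂ A A] [StarModule ℂ A] [TopologicalSpace A] [LocallyCStarAlgebra A]
    (E : ℕ → Type v) [∀ n, AddCommGroup (E n)] [∀ n, Module ℂ (E n)] [∀ n, SMul Aᵐᵒᵖ (E n)]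
    [∀ n, Inner A (E n)] [∀ n, IsHilbertModule A (E n)] : Type v :=
  squareSummable A E

theorem SquareSummable.op_smul {ξ : ∀ n, E n} (hξ : SquareSummable A ξ) (a : A) :
    SquareSummable A (fun n => op a • ξ n) := by
  obtain ⟨l, hl⟩ := hξ
  refine ⟨star a * (l * a), tendsto_iff_seminorm.2 fun p ε hε => ?_⟩
  have hC : 0 < p.1 a * p.1 a + 1 := by have := apply_nonneg p.1 a; positivity
  filter_upwards [tendsto_iff_seminorm.1 hl p (ε / (p.1 a * p.1 a + 1)) (by positivity)] with n hn
  have e : ∑ k ∈ Finset.range n, inner A (op a • ξ k) (op a • ξ k) - star a * (l * a) =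
      star a * ((∑ k ∈ Finset.range n, inner A (ξ k) (ξ k) - l) * a) := by
    simp only [HermitianModule.inner_op_smul_right, HermitianModule.inner_op_smul_left, sub_mul,
      mul_sub, Finset.sum_mul, Finset.mul_sum, mul_assoc]
  rw [e]
  have h1 := p.2.1.mul_le (star a) ((∑ k ∈ Finset.range n, inner A (ξ k) (ξ k) - l) * a)
  have h2 := p.2.1.mul_le (∑ k ∈ Finset.range n, inner A (ξ k) (ξ k) - l) a
  rw [p.2.1.star_eq] at h1
  rw [lt_div_iff₀ hC] at hn
  have h3 := mul_le_mul_of_nonneg_left h2 (apply_nonneg p.1 a)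
  have h4 := apply_nonneg p.1 (∑ k ∈ Finset.range n, inner A (ξ k) (ξ k) - l)
  nlinarith

/-- The coordinatewise action of `A`. -/
instance : SMul Aᵐᵒᵖ (HilbertSum A E) :=
  ⟨fun a ξ => ⟨fun n => a • ξ.1 n, SquareSummable.op_smul ξ.2 a.unop⟩⟩

/-- The inner product `⟨ξ, η⟩ = Σ ⟨ξ_n, η_n⟩`; the series converges. -/
noncomputable instance : Inner A (HilbertSum A E) :=
  ⟨fun ξ η => (SquareSummable.inner_tendsto ξ.2 η.2).choose⟩

theorem HilbertSum.inner_tendsto (ξ η : HilbertSum A E) :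
    Tendsto (fun n => ∑ k ∈ Finset.range n, inner A (ξ.1 k) (η.1 k)) atTop (𝓝 (inner A ξ η)) :=
  (SquareSummable.inner_tendsto ξ.2 η.2).choose_spec

theorem tendsto_seminorm {u : ℕ → A} {l m : A} (f : A → A) (C : CStarSeminorms A → ℝ)
    (hf : ∀ (p : CStarSeminorms A) x y, p.1 (f x - f y) ≤ C p * p.1 (x - y))
    (hu : Tendsto u atTop (𝓝 l)) (hm : Tendsto (fun n => f (u n)) atTop (𝓝 m)) : m = f l := by
  have _ : T2Space A := LocallyCStarAlgebra.t2
  refine tendsto_nhds_unique hm (tendsto_iff_seminorm.2 fun p ε hε => ?_)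
  have hC : 0 < |C p| + 1 := by positivity
  filter_upwards [tendsto_iff_seminorm.1 hu p (ε / (|C p| + 1)) (by positivity)] with n hn
  rw [lt_div_iff₀ hC] at hn
  have h1 := hf p (u n) l
  have h2 := apply_nonneg p.1 (u n - l)
  nlinarith [le_abs_self (C p)]

instance HilbertSum.hermitianModule : HermitianModule A (HilbertSum A E) where
  op_smul_add a x y := Subtype.ext (funext fun _ => HermitianModule.op_smul_add _ _ _)
  add_op_smul a b x := Subtype.ext (funext fun _ => HermitianModule.add_op_smul _ _ _)
  mul_op_smul a b x := Subtype.ext (funext fun _ => HermitianModule.mul_op_smul _ _ _)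
  smul_op_smul z a x := Subtype.ext (funext fun _ => HermitianModule.smul_op_smul _ _ _)
  op_smul_smul z a x := Subtype.ext (funext fun _ => HermitianModule.op_smul_smul _ _ _)
  inner_add_right x y z := by
    have _ : T2Space A := LocallyCStarAlgebra.t2
    have _ : IsTopologicalAddGroup A := LocallyCStarAlgebra.withSeminorms.topologicalAddGroup
    refine tendsto_nhds_unique (HilbertSum.inner_tendsto x (y + z))
      (((HilbertSum.inner_tendsto x y).add (HilbertSum.inner_tendsto x z)).congr fun n => ?_)
    rw [← Finset.sum_add_distrib]
    exact Finset.sum_congr rfl fun k _ => (HermitianModule.inner_add_right _ _ _).symm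
  inner_smul_right z x y := by
    have _ : T2Space A := LocallyCStarAlgebra.t2
    have _ : ContinuousSMul ℂ A := LocallyCStarAlgebra.withSeminorms.continuousSMul
    refine tendsto_nhds_unique (HilbertSum.inner_tendsto x (z • y))
      (((HilbertSum.inner_tendsto x y).const_smul z).congr fun n => ?_)
    rw [Finset.smul_sum]
    exact Finset.sum_congr rfl fun k _ => (HermitianModule.inner_smul_right _ _ _).symm
  inner_op_smul_right a x y := by
    refine tendsto_seminorm (· * a) (fun p => p.1 a) (fun p b c => ?_)
      (HilbertSum.inner_tendsto x y)
      ((HilbertSum.inner_tendsto x (op a • y)).congr fun n => ?_)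
    · rw [← sub_mul, mul_comm (p.1 a)]; exact p.2.1.mul_le _ _
    · rw [Finset.sum_mul]
      exact Finset.sum_congr rfl fun k _ => HermitianModule.inner_op_smul_right _ _ _
  star_inner x y := by
    refine (tendsto_seminorm star (fun _ => 1) (fun p b c => ?_)
      (HilbertSum.inner_tendsto x y)
      ((HilbertSum.inner_tendsto y x).congr fun n => ?_)).symm
    · rw [← star_sub, p.2.1.star_eq, one_mul]
    · rw [star_sum]
      exact Finset.sum_congr rfl fun k _ => (HermitianModule.star_inner _ _).symm

/-- The set of all sequences `(t_n)` with `t_n ∈ M(E_n)` for which `Σ t_n* ∘ t_n` converges strictly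
in `M(A)`. -/
def StrictSum (A : Type u) [NonUnitalRing A] [StarRing A] [Module ℂ A] [IsScalarTower ℂ A A]
    [SMulCommClass ℂ A A] [StarModule ℂ A] [TopologicalSpace A]
    (E : ℕ → Type v) [∀ n, AddCommGroup (E n)] [∀ n, Module ℂ (E n)] [∀ n, SMul Aᵐᵒᵖ (E n)]
    [∀ n, Inner A (E n)] [∀ n, HermitianModule A (E n)] : Type (max u v) :=
  {t : ∀ n, MultiplierModule A (E n) // ∃ l : MultiplierAlg A,
    StrictTendsto (fun n => ∑ k ∈ Finset.range n, (t k).adjoint.comp (t k)) atTop l}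

end hilbertSum

end LocC

/-!
The idea is that a sequence of multipliers `(t_n)` for which `∑ t_n* t_n` converges strictly is the
same thing as the sequence of coordinates of a single operator `T ∈ M(⨁ E_n)`, namely
`T a = (t_n a)_n` with adjoint `T* x = ∑ t_n* x_n` (`StrictSum.equivMultiplier`). Once `M(E)` is known
to be a Hilbert module over the locally C*-algebra `M(A)` for every Hilbert `A`-module `E`, and
`⨁ E_n` to be a Hilbert `A`-module, all structures on the strict direct sum are transported along this
bijection, which becomes a unitary. The formula for the inner product holds because the truncations of
a vector of `⨁ E_n` converge to it (`strictTendsto_sum_proj`). Conversely, the series for `T* x`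
converges by the Cauchy-Schwarz inequality, since the finite sums of `⟨t_k a, t_k a⟩` are at most
`⟨a, l a⟩ ≤ C p(a)²`, where `l` is the strict limit of `∑ t_k* t_k` and `C` a bound for `l`
(`StrictSum.exists_bound`).

Two facts about locally C*-algebras carry the rest.

* Functional calculus (`exists_isFuncCalc`): for a selfadjoint `h` and a continuous `g` with
  `g 0 = 0`, polynomials that approximate `g` uniformly on bounded sets yield a Cauchy sequence in the
  algebra, whose limit is `g(h)` in the C*-algebra of every continuous C*-seminorm. It shows that an
  element with positive image in all these C*-algebras is of the form `b* b`, which gives positivity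
  of the inner product on `⨁ E_n`; and it writes `t* t ∈ M(A)` as `b² - c²` with `b c = 0`, where
  `c = 0` because `⟨a, t* t a⟩ ≥ 0` for all `a` (`exists_adjoint_comp_self_eq`).

* Boundedness (`Adjointable.exists_bound`): an adjointable operator is bounded with respect to every
  continuous C*-seminorm `p`. As `E` need not be metrizable, and completeness of its quotients by
  the seminorms is not available a priori, theorems of Baire type do not apply directly. Instead, functional
  calculus replaces a vector `ζ` by `ζ (1 + ⟨ζ, ζ⟩)⁻¹`, which is bounded by `1` for all seminorms at
  once (`exists_bounded_vector`), and a gliding hump built from such vectors converges in `E`.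

Boundedness makes the `p̃` finite C*-seminorms on `L_A(E)`; completeness of `L_A(E, F)` is then obtained
from pointwise limits of the operators and of their adjoints.
-/

namespace LocC

open Filter Topology MulOpposite

universe u v w

set_option linter.unusedSectionVars false

/-! ### Seminorms on Hilbert modules -/

section basic

variable {A : Type u} [NonUnitalRing A] [StarRing A] [Module ℂ A] [IsScalarTower ℂ A A]
  [SMulCommClass ℂ A A] [StarModule ℂ A]

/-- Every C*-seminorm is the norm of a *-homomorphism into a C*-algebra, which is here equipped with
its spectral order. -/
theorem IsCStarSeminorm.exists_ordered_hom {p : Seminorm ℂ A} (hp : IsCStarSeminorm p) :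
    ∃ (B : Type u) (_ : NonUnitalCStarAlgebra B) (_ : PartialOrder B) (_ : StarOrderedRing B)
      (f : A →⋆ₙₐ[ℂ] B), ∀ a, ‖f a‖ = p a := by
  obtain ⟨B, iB, f, hf⟩ := hp.exists_hom
  exact ⟨B, iB, CStarAlgebra.spectralOrder B, CStarAlgebra.spectralOrderedRing B, f, hf⟩

section family

variable {E : ℕ → Type v} [∀ n, AddCommGroup (E n)] [∀ n, Module ℂ (E n)]
  [∀ n, SMul Aᵐᵒᵖ (E n)] [∀ n, Inner A (E n)] [TopologicalSpace A] [∀ n, IsHilbertModule A (E n)]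

theorem cauchySchwarz_sqrt {p : Seminorm ℂ A} (hp : IsCStarSeminorm p)
    (J : Finset ℕ) (x y : ∀ n, E n) :
    p (∑ k ∈ J, inner A (x k) (y k)) ≤
      √(p (∑ k ∈ J, inner A (x k) (x k))) * √(p (∑ k ∈ J, inner A (y k) (y k))) := by
  rw [← Real.sqrt_mul (apply_nonneg _ _)]
  exact Real.le_sqrt_of_sq_le (cauchySchwarz hp J x y)

/-- The seminorm `(x_n) ↦ p(∑_{k ∈ J} ⟨x_k, x_k⟩)^{1/2}` on sequences, for a finite set `J`. -/
noncomputable def familySeminorm {p : Seminorm ℂ A} (hp : IsCStarSeminorm p) (J : Finset ℕ) :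
    Seminorm ℂ (∀ n, E n) :=
  Seminorm.of (fun x => √(p (∑ k ∈ J, inner A (x k) (x k))))
    (fun x y => by
      have h0 : ∑ k ∈ J, inner A ((x + y) k) ((x + y) k) =
          ∑ k ∈ J, inner A (x k) (x k) + ∑ k ∈ J, inner A (x k) (y k) +
            (∑ k ∈ J, inner A (y k) (x k) + ∑ k ∈ J, inner A (y k) (y k)) := by
        simp only [← Finset.sum_add_distrib]
        refine Finset.sum_congr rfl fun k _ => ?_
        rw [Pi.add_apply, HermitianModule.inner_add_left, HermitianModule.inner_add_right,
          HermitianModule.inner_add_right]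
      have h1 := cauchySchwarz_sqrt hp J x y
      have h2 := cauchySchwarz_sqrt hp J y x
      have h3 := Real.sq_sqrt (apply_nonneg p (∑ k ∈ J, inner A (x k) (x k)))
      have h4 := Real.sq_sqrt (apply_nonneg p (∑ k ∈ J, inner A (y k) (y k)))
      rw [h0]
      refine Real.sqrt_le_iff.2 ⟨by positivity, ?_⟩
      have h5 := map_add_le_add p (∑ k ∈ J, inner A (x k) (x k) + ∑ k ∈ J, inner A (x k) (y k))
        (∑ k ∈ J, inner A (y k) (x k) + ∑ k ∈ J, inner A (y k) (y k))
      have h6 := map_add_le_add p (∑ k ∈ J, inner A (x k) (x k)) (∑ k ∈ J, inner A (x k) (y k))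
      have h7 := map_add_le_add p (∑ k ∈ J, inner A (y k) (x k)) (∑ k ∈ J, inner A (y k) (y k))
      nlinarith)
    (fun z x => by
      have h0 : ∑ k ∈ J, inner A ((z • x) k) ((z • x) k) =
          (z * star z) • ∑ k ∈ J, inner A (x k) (x k) := by
        rw [Finset.smul_sum]
        refine Finset.sum_congr rfl fun k _ => ?_
        rw [Pi.smul_apply, HermitianModule.inner_smul_right, HermitianModule.inner_smul_left,
          mul_smul]
      rw [h0, map_smul_eq_mul, norm_mul, norm_star,
        Real.sqrt_mul (mul_self_nonneg _), Real.sqrt_mul_self (norm_nonneg _)])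

theorem familySeminorm_apply {p : Seminorm ℂ A} (hp : IsCStarSeminorm p) (J : Finset ℕ)
    (x : ∀ n, E n) : familySeminorm hp J x = √(p (∑ k ∈ J, inner A (x k) (x k))) := rfl

theorem familySeminorm_sq {p : Seminorm ℂ A} (hp : IsCStarSeminorm p) (J : Finset ℕ)
    (x : ∀ n, E n) : familySeminorm hp J x ^ 2 = p (∑ k ∈ J, inner A (x k) (x k)) :=
  Real.sq_sqrt (apply_nonneg _ _)

end family

section single

variable {E : Type v} [AddCommGroup E] [Module ℂ E] [SMul Aᵐᵒᵖ E] [Inner A E]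
  [TopologicalSpace A] [IsHilbertModule A E]

/-- The function `modSeminorm E p` as a bundled seminorm. -/
noncomputable def modSem (E : Type v) [AddCommGroup E] [Module ℂ E] [SMul Aᵐᵒᵖ E] [Inner A E]
    [IsHilbertModule A E] (p : CStarSeminorms A) : Seminorm ℂ E :=
  (familySeminorm (E := fun _ => E) p.2.1 {0}).comp (LinearMap.pi fun _ => LinearMap.id)

theorem modSem_apply (p : CStarSeminorms A) (x : E) : modSem E p x = √(p.1 (inner A x x)) := by
  simp [modSem, familySeminorm_apply]

theorem modSeminorm_eq (p : CStarSeminorms A) (x : E) : modSeminorm E p x = modSem E p x :=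
  (modSem_apply p x).symm

theorem modSem_sq (p : CStarSeminorms A) (x : E) : modSem E p x ^ 2 = p.1 (inner A x x) := by
  rw [modSem_apply]; exact Real.sq_sqrt (apply_nonneg _ _)

/-- The Cauchy-Schwarz inequality. -/
theorem inner_le (p : CStarSeminorms A) (x y : E) :
    p.1 (inner A x y) ≤ modSem E p x * modSem E p y := by
  simpa [modSem_apply] using cauchySchwarz_sqrt (E := fun _ => E) p.2.1 {0} (fun _ => x) fun _ => y

theorem modSem_op_smul_le (p : CStarSeminorms A) (a : A) (x : E) :
    modSem E p (op a • x) ≤ modSem E p x * p.1 a := by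
  refine (pow_le_pow_iff_left₀ (apply_nonneg _ _) (by positivity) two_ne_zero).1 ?_
  rw [modSem_sq, HermitianModule.inner_op_smul_right, HermitianModule.inner_op_smul_left, mul_pow,
    modSem_sq]
  have h1 := p.2.1.mul_le (star a * inner A x x) a
  have h2 := p.2.1.mul_le (star a) (inner A x x)
  rw [p.2.1.star_eq] at h2
  nlinarith [apply_nonneg p.1 a]

theorem modSem_le_of_inner_le (p : CStarSeminorms A) {x : E} {C : ℝ} (hC : 0 ≤ C)
    (h : p.1 (inner A x x) ≤ C * modSem E p x) : modSem E p x ≤ C := by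
  rw [← modSem_sq, sq] at h
  by_contra! h'
  nlinarith [hC.trans_lt h']

theorem inner_sub_right (x y z : E) : inner A x (y - z) = inner A x y - inner A x z := by
  rw [sub_eq_add_neg, HermitianModule.inner_add_right, HermitianModule.inner_neg_right,
    ← sub_eq_add_neg]

theorem inner_sub_left (x y z : E) : inner A (x - y) z = inner A x z - inner A y z := by
  rw [sub_eq_add_neg, HermitianModule.inner_add_left, HermitianModule.inner_neg_left,
    ← sub_eq_add_neg]

theorem op_smul_sub (a : A) (x y : E) : op a • (x - y) = op a • x - op a • y := by
  rw [sub_eq_add_neg, HermitianModule.op_smul_add, HermitianModule.op_smul_neg, ← sub_eq_add_neg]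

end single

section locally

variable [TopologicalSpace A] [LocallyCStarAlgebra A]

theorem eq_zero_of_seminorm {a : A} (h : ∀ p : CStarSeminorms A, p.1 a = 0) : a = 0 := by
  have _ : T2Space A := LocallyCStarAlgebra.t2
  by_contra ha
  obtain ⟨p, hp⟩ := LocallyCStarAlgebra.withSeminorms.separating_of_T1 a ha
  exact hp (h p)

theorem eq_of_seminorm {a b : A} (h : ∀ p : CStarSeminorms A, p.1 (a - b) = 0) : a = b :=
  sub_eq_zero.1 (eq_zero_of_seminorm h)

/-- Identities can be checked in the C*-algebras given by the C*-seminorms. -/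
theorem eq_of_hom {a b : A} (h : ∀ (p : CStarSeminorms A) (B : Type u) [NonUnitalCStarAlgebra B]
    [PartialOrder B] [StarOrderedRing B] (f : A →⋆ₙₐ[ℂ] B), (∀ a, ‖f a‖ = p.1 a) → f a = f b) :
    a = b := by
  refine eq_of_seminorm fun p => ?_
  obtain ⟨B, _, _, _, f, hf⟩ := p.2.1.exists_ordered_hom
  rw [← hf, map_sub, h p B f hf, sub_self, norm_zero]

theorem modSem_eq_zero {E : Type v} [AddCommGroup E] [Module ℂ E] [SMul Aᵐᵒᵖ E] [Inner A E]
    [IsHilbertModule A E] {x : E} (h : ∀ p : CStarSeminorms A, modSem E p x = 0) : x = 0 := by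
  refine IsHilbertModule.inner_self_eq_zero (A := A) x (eq_zero_of_seminorm fun p => ?_)
  rw [← modSem_sq, h p, sq, zero_mul]

theorem seminorm_eq_sqrt (p : CStarSeminorms A) (a : A) : p.1 a = √(p.1 (inner A a a)) := by
  rw [selfInner_def, p.2.1.star_mul_self, Real.sqrt_sq (apply_nonneg _ _)]

instance selfHilbertModule : IsHilbertModule A A where
  inner_self_nonneg x := ⟨x, rfl⟩
  inner_self_eq_zero x h := eq_zero_of_seminorm fun p => by
    rw [seminorm_eq_sqrt, h, map_zero, Real.sqrt_zero]
  complete := by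
    have : modSeminorm (A := A) A = fun (p : CStarSeminorms A) (a : A) => p.1 a :=
      funext fun p => funext fun a => (seminorm_eq_sqrt p a).symm
    rw [this]; exact LocallyCStarAlgebra.complete

theorem modSem_self (p : CStarSeminorms A) (a : A) : modSem A p a = p.1 a := by
  rw [modSem_apply, ← seminorm_eq_sqrt]

/-- A Cauchy sequence in a Hilbert module converges. -/
theorem exists_tendsto_of_cauchySeq {E : Type v} [AddCommGroup E] [Module ℂ E] [SMul Aᵐᵒᵖ E]
    [Inner A E] [IsHilbertModule A E] {x : ℕ → E}
    (h : ∀ p : CStarSeminorms A, ∀ ε > 0, ∃ N, ∀ n ≥ N, ∀ m ≥ n, modSem E p (x m - x n) < ε) :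
    ∃ l, ∀ p : CStarSeminorms A, Tendsto (fun n => modSem E p (x n - l)) atTop (𝓝 0) := by
  obtain ⟨l, hl⟩ := IsHilbertModule.complete (A := A) (E := E) (map x atTop) inferInstance (by
    intro p ε hε
    obtain ⟨N, hN⟩ := h p ε hε
    refine ⟨x '' Set.Ici N, image_mem_map (mem_atTop N), ?_⟩
    rintro _ ⟨n, hn, rfl⟩ _ ⟨m, hm, rfl⟩
    rw [modSeminorm_eq]
    rcases le_total n m with h' | h'
    · rw [map_sub_rev]; exact hN n hn m h'
    · exact hN m hm n h')
  refine ⟨l, fun p => ?_⟩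
  have h1 := hl p
  rw [tendsto_map'_iff] at h1
  exact h1.congr fun n => modSeminorm_eq p _

end locally

end basic

/-! ### Functional calculus in locally C*-algebras -/

section funcCalc

variable {A : Type u} [NonUnitalRing A] [StarRing A] [Module ℂ A] [IsScalarTower ℂ A A]
  [SMulCommClass ℂ A A] [StarModule ℂ A] [TopologicalSpace A]

/-- `e` is the result `g(h)` of applying the function `g` to `h`: it is mapped to `g` of the image
of `h` by every *-homomorphism into a C*-algebra which induces a continuous C*-seminorm. -/
def IsFuncCalc (g : ℝ → ℝ) (h e : A) : Prop :=
  ∀ (p : CStarSeminorms A) (B : Type u) [NonUnitalCStarAlgebra B] [PartialOrder B]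
    [StarOrderedRing B] (f : A →⋆ₙₐ[ℂ] B), (∀ a, ‖f a‖ = p.1 a) → f e = cfcₙ g (f h)

/-- `h` has positive image in every C*-algebra given by a continuous C*-seminorm. -/
def LocallyNonneg (h : A) : Prop :=
  ∀ (p : CStarSeminorms A) (B : Type u) [NonUnitalCStarAlgebra B] [PartialOrder B]
    [StarOrderedRing B] (f : A →⋆ₙₐ[ℂ] B), (∀ a, ‖f a‖ = p.1 a) → 0 ≤ f h

theorem locallyNonneg_star_mul_self (b : A) : LocallyNonneg (star b * b) := by
  intro p B _ _ _ f _
  rw [map_mul, map_star]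
  exact star_mul_self_nonneg _

theorem LocallyNonneg.star_eq [LocallyCStarAlgebra A] {h : A} (hh : LocallyNonneg h) :
    star h = h := eq_of_hom fun p B _ _ _ f hf => by
  rw [map_star]; exact (IsSelfAdjoint.of_nonneg (hh p B f hf)).star_eq

theorem isSelfAdjoint_hom {B : Type*} [NonUnitalCStarAlgebra B] (f : A →⋆ₙₐ[ℂ] B) {h : A}
    (hh : star h = h) : IsSelfAdjoint (f h) := by
  rw [IsSelfAdjoint, ← map_star, hh]

/-- Functional calculus by polynomials without constant term. -/
theorem exists_isFuncCalc_polynomial {h : A} (hh : star h = h) (Q : Polynomial ℝ) :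
    ∃ e : A, IsFuncCalc (fun x => x * Q.eval x) h e := by
  induction Q using Polynomial.induction_on' with
  | add P Q hP hQ =>
    obtain ⟨d, hd⟩ := hP
    obtain ⟨e, he⟩ := hQ
    refine ⟨d + e, fun p B _ _ _ f hf => ?_⟩
    rw [map_add, hd p B f hf, he p B f hf, ← cfcₙ_add (fun x => x * P.eval x) _ _
      (by fun_prop) (by simp) (by fun_prop) (by simp)]
    exact cfcₙ_congr fun x _ => by simp [mul_add]
  | monomial n c =>
    induction n with
    | zero =>
      refine ⟨(c : ℂ) • h, fun p B _ _ _ f hf => ?_⟩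
      rw [map_smul, Complex.coe_smul, ← cfcₙ_const_mul_id c (f h) (isSelfAdjoint_hom f hh)]
      exact cfcₙ_congr fun x _ => by simp [mul_comm]
    | succ n ih =>
      obtain ⟨e, he⟩ := ih
      refine ⟨h * e, fun p B _ _ _ f hf => ?_⟩
      have h1 := cfcₙ_id' ℝ (f h) (isSelfAdjoint_hom f hh)
      rw [map_mul, he p B f hf]
      nth_rw 1 [← h1]
      rw [← cfcₙ_mul (fun x => x) _ _ (by fun_prop) (by simp) (by fun_prop) (by simp)]
      exact cfcₙ_congr fun x _ => by simp only [Polynomial.eval_monomial]; ring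

/-- On every interval `[-n, n]`, a continuous function vanishing at `0` is uniformly approximated by
polynomials without constant term. -/
theorem exists_polynomial_mul_near {g : ℝ → ℝ} (hg : Continuous g) (h0 : g 0 = 0) (n : ℕ) :
    ∃ Q : Polynomial ℝ, ∀ x : ℝ, |x| ≤ n → |x * Q.eval x - g x| ≤ 1 / ((n : ℝ) + 1) := by
  have hn : (0 : ℝ) < 1 / ((n : ℝ) + 1) / 2 := by positivity
  obtain ⟨P, hP⟩ := exists_polynomial_near_of_continuousOn (-n) n g hg.continuousOn _ hn
  refine ⟨P.divX, fun x hx => ?_⟩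
  have h1 : x * P.divX.eval x = P.eval x - P.eval 0 := by
    have h := congrArg (Polynomial.eval x) (Polynomial.divX_mul_X_add P)
    rw [Polynomial.eval_add, Polynomial.eval_mul, Polynomial.eval_X, Polynomial.eval_C,
      Polynomial.coeff_zero_eq_eval_zero] at h
    linarith
  have h2 := hP x (abs_le.1 hx)
  have h3 := hP 0 ⟨by simp, by simp⟩
  rw [h0, sub_zero] at h3
  rw [h1]
  calc |P.eval x - P.eval 0 - g x| = |(P.eval x - g x) - P.eval 0| := by congr 1; ring
    _ ≤ _ := abs_sub _ _
    _ ≤ _ := by linarith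

variable [LocallyCStarAlgebra A]

/-- Continuous functional calculus for selfadjoint elements of a locally C*-algebra: a sequence of
polynomials converging to `g` uniformly on bounded sets gives a Cauchy sequence in `A`. -/
theorem exists_isFuncCalc {h : A} (hh : star h = h) {g : ℝ → ℝ} (hg : Continuous g)
    (h0 : g 0 = 0) : ∃ e : A, IsFuncCalc g h e := by
  choose Q hQ using exists_polynomial_mul_near hg h0
  choose e he using fun n => exists_isFuncCalc_polynomial hh (Q n)
  have key : ∀ (p : CStarSeminorms A) (B : Type u) [NonUnitalCStarAlgebra B] [PartialOrder B]
      [StarOrderedRing B] (f : A →⋆ₙₐ[ℂ] B), (∀ a, ‖f a‖ = p.1 a) → ∀ n : ℕ, p.1 h ≤ n →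
      ‖f (e n) - cfcₙ g (f h)‖ ≤ 1 / ((n : ℝ) + 1) := by
    intro p B _ _ _ f hf n hn
    rw [he n p B f hf, ← cfcₙ_sub (fun x => x * (Q n).eval x) g (f h) (by fun_prop) (by simp)
      hg.continuousOn h0]
    refine norm_cfcₙ_le fun x hx => ?_
    have h1 := NonUnitalIsometricContinuousFunctionalCalculus.norm_quasispectrum_le
      (f h) hx (isSelfAdjoint_hom f hh)
    rw [hf] at h1
    exact hQ n x (h1.trans hn)
  have small : ∀ ε > 0, ∃ N : ℕ, ∀ n ≥ N, 1 / ((n : ℝ) + 1) < ε := fun ε hε => by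
    obtain ⟨N, hN⟩ := exists_nat_one_div_lt hε
    refine ⟨N, fun n hn => lt_of_le_of_lt ?_ hN⟩
    gcongr
  obtain ⟨l, hl⟩ := exists_tendsto_of_cauchySeq (A := A) (x := e) (by
    intro p ε hε
    obtain ⟨B, _, _, _, f, hf⟩ := p.2.1.exists_ordered_hom
    obtain ⟨N, hN⟩ := small (ε / 2) (half_pos hε)
    obtain ⟨M, hM⟩ := exists_nat_ge (p.1 h)
    refine ⟨max N M, fun n hn m hm => ?_⟩
    have hMn : (M : ℝ) ≤ n := Nat.cast_le.2 (le_of_max_le_right hn)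
    have hnm : (n : ℝ) ≤ m := Nat.cast_le.2 hm
    have h1 := key p B f hf n (hM.trans hMn)
    have h2 := key p B f hf m (hM.trans (hMn.trans hnm))
    have h3 := hN n (le_of_max_le_left hn)
    have h4 := hN m ((le_of_max_le_left hn).trans hm)
    rw [modSem_self, ← hf, map_sub, ← sub_sub_sub_cancel_right _ _ (cfcₙ g (f h))]
    have h5 := norm_sub_le (f (e m) - cfcₙ g (f h)) (f (e n) - cfcₙ g (f h))
    linarith)
  refine ⟨l, fun p B _ _ _ f hf => ?_⟩
  have h1 : Tendsto (fun n => f (e n)) atTop (𝓝 (f l)) := by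
    rw [tendsto_iff_norm_sub_tendsto_zero]
    exact (hl p).congr fun n => by rw [modSem_self, ← hf, map_sub]
  refine tendsto_nhds_unique h1 ?_
  rw [tendsto_iff_norm_sub_tendsto_zero]
  obtain ⟨M, hM⟩ := exists_nat_ge (p.1 h)
  refine squeeze_zero' (Eventually.of_forall fun _ => norm_nonneg _) ?_
    tendsto_one_div_add_atTop_nhds_zero_nat
  filter_upwards [eventually_ge_atTop M] with n hn
  exact key p B f hf n (hM.trans (Nat.cast_le.2 hn))

theorem IsFuncCalc.star_eq {g : ℝ → ℝ} {h e : A} (he : IsFuncCalc g h e) : star e = e :=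
  eq_of_hom fun p B _ _ _ f hf => by
    rw [map_star, he p B f hf]; exact (cfcₙ_predicate g (f h)).star_eq

/-- A selfadjoint element is the difference of two positive elements with product zero. -/
theorem exists_sq_sub_sq {h : A} (hh : star h = h) : ∃ b c : A, star b = b ∧ star c = c ∧
    h = b * b - c * c ∧ b * c = 0 ∧ c * b = 0 := by
  have hc1 : Continuous fun x : ℝ => √x := Real.continuous_sqrt
  have hc2 : Continuous fun x : ℝ => √(-x) := by fun_prop
  have hs : ∀ x : ℝ, √x * √(-x) = 0 := fun x => by
    rcases le_total 0 x with h | h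
    · rw [Real.sqrt_eq_zero_of_nonpos (neg_nonpos.2 h), mul_zero]
    · rw [Real.sqrt_eq_zero_of_nonpos h, zero_mul]
  obtain ⟨b, hb⟩ := exists_isFuncCalc hh hc1 (by simp)
  obtain ⟨c, hc⟩ := exists_isFuncCalc hh hc2 (by simp)
  refine ⟨b, c, hb.star_eq, hc.star_eq, ?_, ?_, ?_⟩ <;> refine eq_of_hom fun p B _ _ _ f hf => ?_
  · rw [map_sub, map_mul, map_mul, hb p B f hf, hc p B f hf,
      ← cfcₙ_mul (fun x : ℝ => √x) _ _ hc1.continuousOn (by simp) hc1.continuousOn (by simp),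
      ← cfcₙ_mul (fun x : ℝ => √(-x)) _ _ hc2.continuousOn (by simp) hc2.continuousOn (by simp),
      ← cfcₙ_sub (fun x : ℝ => √x * √x) (fun x => √(-x) * √(-x)) _ (hc1.mul hc1).continuousOn
        (by simp) (hc2.mul hc2).continuousOn (by simp)]
    conv_lhs => rw [← cfcₙ_id' ℝ (f h) (isSelfAdjoint_hom f hh)]
    refine cfcₙ_congr fun x _ => ?_
    rcases le_total 0 x with h | h
    · simp [Real.sqrt_eq_zero_of_nonpos (neg_nonpos.2 h), Real.mul_self_sqrt h]
    · simp [Real.sqrt_eq_zero_of_nonpos h, Real.mul_self_sqrt (neg_nonneg.2 h)]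
  · rw [map_mul, hb p B f hf, hc p B f hf, map_zero,
      ← cfcₙ_mul (fun x : ℝ => √x) _ _ hc1.continuousOn (by simp) hc2.continuousOn (by simp)]
    simp only [hs, cfcₙ_const_zero]
  · rw [map_mul, hb p B f hf, hc p B f hf, map_zero,
      ← cfcₙ_mul (fun x : ℝ => √(-x)) _ _ hc2.continuousOn (by simp) hc1.continuousOn (by simp)]
    simp only [mul_comm, hs, cfcₙ_const_zero]

theorem eq_zero_of_star_mul_self {c : A} (h : star c * c = 0) : c = 0 :=
  eq_zero_of_seminorm fun p => by
    have := p.2.1.star_mul_self c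
    rw [h, map_zero] at this
    exact pow_eq_zero_iff two_ne_zero |>.1 this.symm

theorem LocallyNonneg.eq_zero {h : A} (h1 : LocallyNonneg h) (h2 : LocallyNonneg (-h)) : h = 0 :=
  eq_of_hom fun p B _ _ _ f hf => by
    have h3 := h2 p B f hf
    rw [map_neg, neg_nonneg] at h3
    rw [map_zero]
    exact le_antisymm h3 (h1 p B f hf)

/-- A locally nonnegative element is positive. -/
theorem LocallyNonneg.exists_star_mul_self {h : A} (hh : LocallyNonneg h) :
    ∃ b : A, h = star b * b := by
  obtain ⟨b, c, hb, hc, e, hbc, hcb⟩ := exists_sq_sub_sq hh.star_eq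
  have h1 : star (c * c) * (c * c) = -(star c * h * c) := by
    rw [e, star_mul, hc, mul_sub, sub_mul, ← mul_assoc c b b, hcb, zero_mul, zero_mul, zero_sub,
      neg_neg]
    simp only [mul_assoc]
  have h2 : LocallyNonneg (-(star (c * c) * (c * c))) := by
    intro p B _ _ _ f hf
    rw [h1, neg_neg, map_mul, map_mul, map_star]
    exact star_left_conjugate_nonneg (hh p B f hf) _
  have h3 := eq_zero_of_star_mul_self ((locallyNonneg_star_mul_self (c * c)).eq_zero h2)
  exact ⟨b, by rw [e, h3, sub_zero, hb]⟩

/-- The element `d = a (1 + a)⁻¹` for positive `a`. Note that `a - d a - a d + d a d = d - d²`. -/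
theorem LocallyNonneg.exists_quasiInverse {a : A} (ha : LocallyNonneg a) :
    ∃ d : A, star d = d ∧ d + a * d = a ∧ d + d * a = a ∧
      ∀ p : CStarSeminorms A, p.1 (d - d * d) ≤ 1 := by
  have hpos : ∀ x : ℝ, 0 < 1 + |x| := fun x => by positivity
  have hg : Continuous fun x : ℝ => x / (1 + |x|) :=
    continuous_id.div (by fun_prop) fun x => (hpos x).ne'
  obtain ⟨d, hd⟩ := exists_isFuncCalc ha.star_eq hg (by simp)
  have h1 : d + a * d = a := eq_of_hom fun p B _ _ _ f hf => by
    have hsa := isSelfAdjoint_hom f ha.star_eq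
    have h2 := cfcₙ_id' ℝ (f a) hsa
    rw [map_add, map_mul, hd p B f hf]
    nth_rw 2 [← h2]
    nth_rw 4 [← h2]
    rw [← cfcₙ_mul (fun x : ℝ => x) _ _ (by fun_prop) (by simp) hg.continuousOn (by simp),
      ← cfcₙ_add _ _ _ hg.continuousOn (by simp) (by fun_prop) (by simp)]
    refine cfcₙ_congr fun x hx => ?_
    have hx0 := quasispectrum_nonneg_of_nonneg _ (ha p B f hf) x hx
    have := hpos x
    rw [abs_of_nonneg hx0] at this ⊢
    field_simp
  refine ⟨d, hd.star_eq, h1, ?_, fun p => ?_⟩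
  · have := congrArg star h1
    rwa [star_add, star_mul, hd.star_eq, ha.star_eq] at this
  · obtain ⟨B, _, _, _, f, hf⟩ := p.2.1.exists_ordered_hom
    rw [← hf, map_sub, map_mul, hd p B f hf,
      ← cfcₙ_mul (fun x : ℝ => x / (1 + |x|)) _ _ hg.continuousOn (by simp) hg.continuousOn
        (by simp), ← cfcₙ_sub _ (fun x : ℝ => x / (1 + |x|) * (x / (1 + |x|))) _ hg.continuousOn
        (by simp) (hg.mul hg).continuousOn (by simp)]
    refine norm_cfcₙ_le fun x hx => ?_
    have hx0 := quasispectrum_nonneg_of_nonneg _ (ha p B f hf) x hx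
    rw [abs_of_nonneg hx0]
    have h2 : 0 ≤ x / (1 + x) := by positivity
    have h3 : x / (1 + x) ≤ 1 := (div_le_one (by positivity)).2 (by linarith)
    rw [Real.norm_eq_abs, abs_le]
    constructor <;> nlinarith

end funcCalc

/-! ### Boundedness of adjointable operators -/

section bounded

variable {A : Type u} [NonUnitalRing A] [StarRing A] [Module ℂ A] [IsScalarTower ℂ A A]
  [SMulCommClass ℂ A A] [StarModule ℂ A] [TopologicalSpace A] [LocallyCStarAlgebra A]
  {E : Type v} [AddCommGroup E] [Module ℂ E] [SMul Aᵐᵒᵖ E] [Inner A E] [IsHilbertModule A E]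
  {F : Type w} [AddCommGroup F] [Module ℂ F] [SMul Aᵐᵒᵖ F] [Inner A F] [IsHilbertModule A F]

theorem locallyNonneg_inner_self (x : E) : LocallyNonneg (inner A x x) := by
  obtain ⟨b, hb⟩ := IsHilbertModule.inner_self_nonneg (A := A) x
  rw [hb]; exact locallyNonneg_star_mul_self b

/-- For every `ζ` and `p` there is a vector `u`, bounded by `1` for all seminorms at once, which
almost norms `ζ` with respect to `p`. It is the element `ζ (1 + ⟨ζ, ζ⟩)⁻¹` for normalized `ζ`. -/
theorem exists_bounded_vector (p : CStarSeminorms A) (ζ : E) :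
    ∃ u : E, (∀ q : CStarSeminorms A, modSem E q u ≤ 1) ∧
      modSem E p ζ / 2 ≤ p.1 (inner A ζ u) := by
  rcases (apply_nonneg (modSem E p) ζ).eq_or_lt with h0 | h0
  · exact ⟨0, fun q => by simp, by rw [← h0, zero_div]; exact apply_nonneg _ _⟩
  set r := modSem E p ζ with hr
  set z : E := ((r⁻¹ : ℝ) : ℂ) • ζ with hz
  have hzp : modSem E p z = 1 := by
    rw [hz, map_smul_eq_mul, Complex.norm_real, Real.norm_of_nonneg (by positivity), ← hr,
      inv_mul_cancel₀ h0.ne']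
  obtain ⟨d, hd, h1, h2, h3⟩ := (locallyNonneg_inner_self (A := A) z).exists_quasiInverse
  set a : A := inner A z z with ha
  have e1 : inner A z (z - op d • z) = d := by
    rw [inner_sub_right, HermitianModule.inner_op_smul_right, ← ha]
    nth_rw 1 [← h1]
    rw [add_sub_cancel_right]
  refine ⟨z - op d • z, fun q => ?_, ?_⟩
  · have e2 : inner A (z - op d • z) (z - op d • z) = d - d * d := by
      rw [inner_sub_left, HermitianModule.inner_op_smul_left, e1, hd]
    rw [modSem_apply, e2]
    exact Real.sqrt_le_one.2 (h3 q)
  · have e3 : ζ = (r : ℂ) • z := by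
      rw [hz, smul_smul, ← Complex.ofReal_mul, mul_inv_cancel₀ h0.ne', Complex.ofReal_one, one_smul]
    have h4 : p.1 a = 1 := by rw [ha, ← modSem_sq, hzp, one_pow]
    have h5 : p.1 a ≤ p.1 d + p.1 d * p.1 a := by
      conv_lhs => rw [← h2]
      exact (map_add_le_add _ _ _).trans (by gcongr; exact p.2.1.mul_le _ _)
    rw [h4] at h5
    have e4 : inner A ζ (z - op d • z) = (r : ℂ) • d := by
      conv_lhs => rw [e3]
      rw [HermitianModule.inner_smul_left, e1]
      congr 1
      exact Complex.conj_ofReal r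
    rw [e4, map_smul_eq_mul, Complex.norm_real, Real.norm_of_nonneg h0.le]
    nlinarith

/-- A uniform boundedness principle: a family of vectors of a Hilbert module which is pointwise
bounded with respect to `p`, as a family of functionals, is bounded with respect to `p`. The proof is
a gliding hump argument with vectors that are bounded for all seminorms at once, so that no Baire
property of `E` is needed. -/
theorem bounded_of_pointwise_bounded (p : CStarSeminorms A) {ι : Type*} (ζ : ι → E)
    (h : ∀ x : E, ∃ C : ℝ, ∀ i, p.1 (inner A (ζ i) x) ≤ C) :
    ∃ C : ℝ, ∀ i, modSem E p (ζ i) ≤ C := by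
  by_contra! hne
  choose i hi using fun n : ℕ => hne (n * 4 ^ n)
  -- One of `x ± 4⁻ⁿ u` has a large inner product with `ζ (i n)`, since their difference has.
  have step : ∀ (n : ℕ) (x : E), ∃ y : E,
      (∀ q : CStarSeminorms A, modSem E q (y - x) ≤ (4 ^ n)⁻¹) ∧
      (4 ^ n)⁻¹ * (modSem E p (ζ (i n)) / 2) ≤ p.1 (inner A (ζ (i n)) y) := by
    intro n x
    obtain ⟨u, hu, hu'⟩ := exists_bounded_vector p (ζ (i n))
    set c : ℝ := (4 ^ n)⁻¹ with hc
    have hc0 : 0 < c := by positivity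
    set v : E := (c : ℂ) • u with hv
    have hvq : ∀ q : CStarSeminorms A, modSem E q v ≤ c := fun q => by
      rw [hv, map_smul_eq_mul, Complex.norm_real, Real.norm_of_nonneg hc0.le]
      exact mul_le_of_le_one_right hc0.le (hu q)
    have hvp : c * (modSem E p (ζ (i n)) / 2) ≤ p.1 (inner A (ζ (i n)) v) := by
      rw [hv, HermitianModule.inner_smul_right, map_smul_eq_mul, Complex.norm_real,
        Real.norm_of_nonneg hc0.le]
      gcongr
    by_cases hx : c * (modSem E p (ζ (i n)) / 2) ≤ p.1 (inner A (ζ (i n)) (x + v))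
    · exact ⟨x + v, fun q => by rw [add_sub_cancel_left]; exact hvq q, hx⟩
    · refine ⟨x - v, fun q => by rw [sub_sub_cancel_left, map_neg_eq_map]; exact hvq q, ?_⟩
      have h2 : (2 : ℂ) • inner A (ζ (i n)) v =
          inner A (ζ (i n)) (x + v) - inner A (ζ (i n)) (x - v) := by
        rw [inner_sub_right, HermitianModule.inner_add_right, two_smul]; abel
      have h3 := map_sub_le_add p.1 (inner A (ζ (i n)) (x + v)) (inner A (ζ (i n)) (x - v))
      rw [← h2, map_smul_eq_mul, Complex.norm_ofNat] at h3
      linarith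
  choose f hf hf' using step
  set x : ℕ → E := fun n => Nat.rec 0 (fun n y => f n y) n with hx
  have hsucc : ∀ n, x (n + 1) = f n (x n) := fun n => rfl
  have hdiff : ∀ (q : CStarSeminorms A) (n k : ℕ),
      modSem E q (x (n + k) - x n) ≤ 4 / 3 * ((4 ^ n)⁻¹ - (4 ^ (n + k))⁻¹) := by
    intro q n k
    induction k with
    | zero => simp
    | succ k ih =>
      have h1 := hf (n + k) (x (n + k)) q
      rw [← hsucc] at h1
      have h2 := map_add_le_add (modSem E q) (x (n + k + 1) - x (n + k)) (x (n + k) - x n)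
      rw [sub_add_sub_cancel] at h2
      have h3 : ((4 : ℝ) ^ (n + (k + 1)))⁻¹ = (4 ^ (n + k))⁻¹ / 4 := by
        rw [← add_assoc, pow_succ, mul_inv, div_eq_mul_inv]
      rw [h3, ← add_assoc]
      linarith
  have hdiff' : ∀ (q : CStarSeminorms A) (n m : ℕ), n ≤ m →
      modSem E q (x m - x n) ≤ 4 / 3 * (4 ^ n)⁻¹ := by
    intro q n m hnm
    obtain ⟨k, rfl⟩ := Nat.exists_eq_add_of_le hnm
    refine (hdiff q n k).trans ?_
    have : (0 : ℝ) < (4 ^ (n + k))⁻¹ := by positivity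
    linarith
  have hlim : Tendsto (fun n : ℕ => 4 / 3 * ((4 : ℝ) ^ n)⁻¹) atTop (𝓝 0) := by
    have := (tendsto_pow_atTop_nhds_zero_of_lt_one (r := (4 : ℝ)⁻¹) (by norm_num)
      (by norm_num)).const_mul (4 / 3)
    simpa using this
  obtain ⟨l, hl⟩ := exists_tendsto_of_cauchySeq (A := A) (x := x) (by
    intro q ε hε
    obtain ⟨N, hN⟩ := eventually_atTop.1 (hlim.eventually (gt_mem_nhds hε))
    exact ⟨N, fun n hn m hm => (hdiff' q n m hm).trans_lt (hN n hn)⟩)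
  have hl' : ∀ n, modSem E p (l - x (n + 1)) ≤ (4 ^ n)⁻¹ / 3 := by
    intro n
    have h1 : ∀ᶠ m in atTop, modSem E p (l - x (n + 1)) ≤
        modSem E p (x m - l) + (4 ^ n)⁻¹ / 3 := by
      filter_upwards [eventually_ge_atTop (n + 1)] with m hm
      have h2 := hdiff' p (n + 1) m hm
      have h3 := map_sub_le_add (modSem E p) (x m - x (n + 1)) (x m - l)
      rw [sub_sub_sub_cancel_left] at h3
      have h4 : 4 / 3 * ((4 : ℝ) ^ (n + 1))⁻¹ = (4 ^ n)⁻¹ / 3 := by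
        rw [pow_succ, mul_inv]; ring
      linarith
    have h5 := (hl p).add_const (((4 : ℝ) ^ n)⁻¹ / 3)
    rw [zero_add] at h5
    exact ge_of_tendsto h5 h1
  obtain ⟨C, hC⟩ := h l
  obtain ⟨n, hn⟩ := exists_nat_gt (6 * C)
  have h1 := hC (i n)
  have h2 := hf' n (x n)
  rw [← hsucc] at h2
  have h3 := inner_le p (ζ (i n)) (l - x (n + 1))
  have h4 := map_sub_le_add p.1 (inner A (ζ (i n)) l) (inner A (ζ (i n)) (l - x (n + 1)))
  rw [← inner_sub_right, sub_sub_cancel] at h4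
  have h5 := mul_le_mul_of_nonneg_left (hl' n) (apply_nonneg (modSem E p) (ζ (i n)))
  have h6 : (n : ℝ) ≤ (4 ^ n)⁻¹ * modSem E p (ζ (i n)) := by
    rw [inv_mul_eq_div, le_div_iff₀ (by positivity)]; exact (hi n).le
  nlinarith

theorem le_mul_of_le_of_unit_ball {V : Type*} [AddCommGroup V] [Module ℂ V] (q r : Seminorm ℂ V)
    {C : ℝ} (h : ∀ x, q x ≤ 1 → r x ≤ C) (x : V) : r x ≤ C * q x := by
  -- Normalizing by `q x + δ` with `δ → 0` covers the case `q x = 0`.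
  have key : ∀ δ > 0, r x ≤ C * q x + C * δ := by
    intro δ hδ
    have hr : 0 < q x + δ := add_pos_of_nonneg_of_pos (apply_nonneg _ _) hδ
    have hn : ‖(((q x + δ)⁻¹ : ℝ) : ℂ)‖ = (q x + δ)⁻¹ := by
      rw [Complex.norm_real, Real.norm_of_nonneg (inv_pos.2 hr).le]
    have h1 := h ((((q x + δ)⁻¹ : ℝ) : ℂ) • x) (by
      rw [map_smul_eq_mul, hn, inv_mul_le_iff₀ hr]; linarith)
    rw [map_smul_eq_mul, hn, inv_mul_le_iff₀ hr] at h1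
    linarith
  have hlim : Tendsto (fun δ : ℝ => C * q x + C * δ) (𝓝[>] 0) (𝓝 (C * q x)) := by
    have : Continuous fun δ : ℝ => C * q x + C * δ := by fun_prop
    simpa using (this.tendsto 0).mono_left nhdsWithin_le_nhds
  exact ge_of_tendsto hlim (by filter_upwards [self_mem_nhdsWithin] with δ hδ using key δ hδ)

/-- Adjointable operators are bounded with respect to every continuous C*-seminorm. -/
theorem Adjointable.exists_bound (T : Adjointable A E F) (p : CStarSeminorms A) :
    ∃ C : ℝ, 0 ≤ C ∧ ∀ x : E, modSem F p (T.toLin x) ≤ C * modSem E p x := by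
  obtain ⟨C, hC⟩ := bounded_of_pointwise_bounded (E := F) p
    (fun x : {x : E // modSem E p x ≤ 1} => T.toLin x.1) (fun y => ⟨modSem E p (T.adj y), fun x => by
      rw [T.inner_eq]
      exact (inner_le p _ _).trans (mul_le_of_le_one_left (apply_nonneg _ _) x.2)⟩)
  exact ⟨C, (apply_nonneg _ _).trans (hC ⟨0, by simp⟩),
    le_mul_of_le_of_unit_ball (modSem E p) ((modSem F p).comp T.toLin) fun x hx => hC ⟨x, hx⟩⟩

end bounded

/-! ### Convergence in Hilbert modules and the locally C*-algebra of adjointable operators -/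

section convergence

variable {A : Type u} [NonUnitalRing A] [StarRing A] [Module ℂ A] [IsScalarTower ℂ A A]
  [SMulCommClass ℂ A A] [StarModule ℂ A] [TopologicalSpace A] [LocallyCStarAlgebra A]
  {E : Type v} [AddCommGroup E] [Module ℂ E] [SMul Aᵐᵒᵖ E] [Inner A E] [IsHilbertModule A E]
  {F : Type w} [AddCommGroup F] [Module ℂ F] [SMul Aᵐᵒᵖ F] [Inner A F] [IsHilbertModule A F]

variable (A) in
/-- Convergence in a Hilbert `A`-module, for all the seminorms `modSeminorm E p`. -/
def ModTendsto {ι : Type*} (f : ι → E) (l : Filter ι) (x : E) : Prop :=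
  ∀ p : CStarSeminorms A, Tendsto (fun i => modSem E p (f i - x)) l (𝓝 0)

namespace ModTendsto

variable {ι : Type*} {f g : ι → E} {l : Filter ι} {x y : E}

theorem of_le {f' : ι → F} {y : F} (hf : ModTendsto A f l x)
    (h : ∀ p : CStarSeminorms A, ∃ C : ℝ, ∀ i, modSem F p (f' i - y) ≤ C * modSem E p (f i - x)) :
    ModTendsto A f' l y := fun p => by
  obtain ⟨C, hC⟩ := h p
  refine squeeze_zero (fun _ => apply_nonneg _ _) hC ?_
  simpa using (hf p).const_mul C

theorem unique [l.NeBot] (h1 : ModTendsto A f l x) (h2 : ModTendsto A f l y) : x = y := by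
  refine sub_eq_zero.1 (modSem_eq_zero (A := A) fun p => ?_)
  refine le_antisymm (ge_of_tendsto (f := fun i => modSem E p (f i - y) + modSem E p (f i - x))
    (by simpa using (h2 p).add (h1 p)) (Eventually.of_forall fun i => ?_)) (apply_nonneg _ _)
  have := map_sub_le_add (modSem E p) (f i - y) (f i - x)
  rwa [sub_sub_sub_cancel_left] at this

theorem add (h1 : ModTendsto A f l x) (h2 : ModTendsto A g l y) :
    ModTendsto A (fun i => f i + g i) l (x + y) := fun p => by
  refine squeeze_zero (fun _ => apply_nonneg _ _) (fun i => ?_)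
    (g := fun i => modSem E p (f i - x) + modSem E p (g i - y)) (by simpa using (h1 p).add (h2 p))
  rw [add_sub_add_comm]
  exact map_add_le_add _ _ _

theorem const_smul (h : ModTendsto A f l x) (z : ℂ) : ModTendsto A (fun i => z • f i) l (z • x) :=
  h.of_le fun p => ⟨‖z‖, fun i => by rw [← smul_sub, map_smul_eq_mul]⟩

theorem op_smul (h : ModTendsto A f l x) (a : A) :
    ModTendsto A (fun i => op a • f i) l (op a • x) :=
  h.of_le fun p => ⟨p.1 a, fun i => by rw [← op_smul_sub, mul_comm]; exact modSem_op_smul_le p a _⟩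

theorem inner_right (h : ModTendsto A f l x) (y : E) :
    ModTendsto A (fun i => inner A y (f i)) l (inner A y x) :=
  h.of_le fun p => ⟨modSem E p y, fun i => by
    rw [← inner_sub_right, modSem_self]; exact inner_le p y _⟩

theorem inner_left (h : ModTendsto A f l x) (y : E) :
    ModTendsto A (fun i => inner A (f i) y) l (inner A x y) :=
  h.of_le fun p => ⟨modSem E p y, fun i => by
    rw [← inner_sub_left, modSem_self, mul_comm]; exact inner_le p _ y⟩

theorem map (h : ModTendsto A f l x) (T : Adjointable A E F) :
    ModTendsto A (fun i => T.toLin (f i)) l (T.toLin x) :=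
  h.of_le fun p => by
    obtain ⟨C, -, hC⟩ := T.exists_bound p
    exact ⟨C, fun i => by rw [← map_sub]; exact hC _⟩

theorem congr (h : ModTendsto A f l x) (hfg : ∀ i, f i = g i) : ModTendsto A g l x := by
  rwa [← funext hfg]

theorem tendsto {a : A} {f : ι → A} (h : ModTendsto A f l a) : Tendsto f l (𝓝 a) := by
  rw [LocallyCStarAlgebra.withSeminorms.tendsto_nhds f a]
  intro p ε hε
  filter_upwards [(h p).eventually (gt_mem_nhds hε)] with i hi
  rwa [modSem_self] at hi

theorem of_tendsto {a : A} {f : ι → A} (h : Tendsto f l (𝓝 a)) : ModTendsto A f l a := by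
  intro p
  rw [LocallyCStarAlgebra.withSeminorms.tendsto_nhds f a] at h
  rw [Metric.tendsto_nhds]
  intro ε hε
  filter_upwards [h p ε hε] with i hi
  rwa [modSem_self, dist_zero_right, Real.norm_of_nonneg (apply_nonneg _ _)]

theorem norm_le [l.NeBot] (h : ModTendsto A f l x) (p : CStarSeminorms A) {C : ℝ}
    (hC : ∀ᶠ i in l, modSem E p (f i) ≤ C) : modSem E p x ≤ C := by
  have h1 := (h p).add_const C
  rw [zero_add] at h1
  refine ge_of_tendsto h1 ?_
  filter_upwards [hC] with i hi
  have := map_sub_le_add (modSem E p) (f i) (f i - x)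
  rw [sub_sub_cancel] at this
  linarith

end ModTendsto

/-- Completeness of a Hilbert module in terms of convergence. -/
theorem exists_modTendsto {l : Filter E} [l.NeBot]
    (h : ∀ p : CStarSeminorms A, ∀ ε > 0, ∃ s ∈ l, ∀ x ∈ s, ∀ y ∈ s, modSem E p (x - y) < ε) :
    ∃ x, ModTendsto A (fun y : E => y) l x := by
  obtain ⟨x, hx⟩ := IsHilbertModule.complete (A := A) l inferInstance (by simpa only [modSeminorm_eq])
  exact ⟨x, fun p => by simpa only [modSeminorm_eq] using hx p⟩

end convergence

section operators

variable {A : Type u} [NonUnitalRing A] [StarRing A] [Module ℂ A] [IsScalarTower ℂ A A]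
  [SMulCommClass ℂ A A] [StarModule ℂ A] [TopologicalSpace A] [LocallyCStarAlgebra A]
  {E : Type v} [AddCommGroup E] [Module ℂ E] [SMul Aᵐᵒᵖ E] [Inner A E] [IsHilbertModule A E]
  {F : Type w} [AddCommGroup F] [Module ℂ F] [SMul Aᵐᵒᵖ F] [Inner A F] [IsHilbertModule A F]
  {G : Type*} [AddCommGroup G] [Module ℂ G] [SMul Aᵐᵒᵖ G] [Inner A G] [IsHilbertModule A G]

theorem isOpen_seminorm_sub_lt {V ι : Type*} [AddCommGroup V] [Module ℂ V] [TopologicalSpace V]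
    {q : SeminormFamily ℂ V ι} (hq : WithSeminorms q) (i : ι) (T₀ : V) (ε : ENNReal) :
    IsOpen {T | ENNReal.ofReal (q i (T - T₀)) < ε} := by
  have _ : IsTopologicalAddGroup V := hq.topologicalAddGroup
  have hc : Continuous fun S => ENNReal.ofReal (q i (S - T₀)) :=
    ENNReal.continuous_ofReal.comp
      ((hq.continuous_seminorm i).comp (continuous_id.sub continuous_const))
  exact hc.isOpen_preimage _ (isOpen_Iio (a := ε))

/-- The translates of the balls of a family of seminorms generate the topology it determines. -/
theorem withSeminorms_of_eq_generateFrom {V ι : Type*} [AddCommGroup V] [Module ℂ V]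
    [t : TopologicalSpace V] (q : SeminormFamily ℂ V ι)
    (ht : t = TopologicalSpace.generateFrom {U | ∃ (i : ι) (T₀ : V) (ε : ENNReal), 0 < ε ∧
        U = {T | ENNReal.ofReal (q i (T - T₀)) < ε}}) : WithSeminorms q := by
  have hq : @WithSeminorms _ _ _ _ _ _ q q.moduleFilterBasis.topology :=
    @WithSeminorms.mk _ _ _ _ _ _ q q.moduleFilterBasis.topology rfl
  refine ⟨le_antisymm ?_ ?_⟩
  · intro U hU
    rw [@WithSeminorms.isOpen_iff_mem_balls _ _ _ _ _ _ q.moduleFilterBasis.topology q hq] at hU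
    rw [isOpen_iff_mem_nhds]
    intro T hT
    obtain ⟨s, r, hr, hs⟩ := hU T hT
    have hball : ∀ i, {S | ENNReal.ofReal (q i (S - T)) < ENNReal.ofReal r} ∈ 𝓝 T := fun i => by
      have ho : IsOpen {S | ENNReal.ofReal (q i (S - T)) < ENNReal.ofReal r} := by
        rw [ht]
        exact TopologicalSpace.isOpen_generateFrom_of_mem
          ⟨i, T, ENNReal.ofReal r, ENNReal.ofReal_pos.2 hr, rfl⟩
      exact ho.mem_nhds (by simpa using hr)
    refine mem_of_superset ((Filter.biInter_finset_mem s).2 fun i _ => hball i) fun S hS => hs ?_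
    rw [Seminorm.mem_ball]
    exact Seminorm.finset_sup_apply_lt hr fun i hi =>
      (ENNReal.ofReal_lt_ofReal_iff hr).1 (Set.mem_iInter₂.1 hS i hi)
  · rw [ht]
    refine le_generateFrom ?_
    rintro U ⟨i, T, ε, -, rfl⟩
    exact @isOpen_seminorm_sub_lt _ _ _ _ q.moduleFilterBasis.topology q hq i T ε

namespace Adjointable

theorem opSeminorm_le {p : CStarSeminorms A} {T : Adjointable A E F} {C : ℝ} (hC : 0 ≤ C)
    (h : ∀ x, modSem F p (T.toLin x) ≤ C * modSem E p x) : opSeminorm p T ≤ ENNReal.ofReal C := by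
  refine iSup₂_le fun x hx => ENNReal.ofReal_le_ofReal ?_
  rw [modSeminorm_eq] at hx ⊢
  exact (h x).trans (mul_le_of_le_one_right hC hx)

theorem opSeminorm_ne_top (p : CStarSeminorms A) (T : Adjointable A E F) :
    opSeminorm p T ≠ ⊤ := by
  obtain ⟨C, hC, h⟩ := T.exists_bound p
  exact ((opSeminorm_le hC h).trans_lt ENNReal.ofReal_lt_top).ne

theorem le_opSeminorm_toReal (p : CStarSeminorms A) (T : Adjointable A E F) (x : E) :
    modSem F p (T.toLin x) ≤ (opSeminorm p T).toReal * modSem E p x := by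
  refine le_mul_of_le_of_unit_ball (modSem E p) ((modSem F p).comp T.toLin) (fun x hx => ?_) x
  rw [← ENNReal.ofReal_le_iff_le_toReal (opSeminorm_ne_top p T)]
  rw [← modSeminorm_eq] at hx
  refine le_trans (le_of_eq ?_)
    (le_iSup₂ (f := fun (x : E) (_ : modSeminorm E p x ≤ 1) =>
      ENNReal.ofReal (modSeminorm F p (T.toLin x))) x hx)
  rw [modSeminorm_eq]; rfl

theorem opSeminorm_toReal_le {p : CStarSeminorms A} {T : Adjointable A E F} {C : ℝ} (hC : 0 ≤ C)
    (h : ∀ x, modSem F p (T.toLin x) ≤ C * modSem E p x) : (opSeminorm p T).toReal ≤ C :=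
  ENNReal.toReal_le_of_le_ofReal hC (opSeminorm_le hC h)

/-- The operator seminorm `p̃` on `L_A(E, F)` as a real-valued seminorm. -/
noncomputable def opSem (p : CStarSeminorms A) : Seminorm ℂ (Adjointable A E F) :=
  Seminorm.ofSMulLE (fun T => (opSeminorm p T).toReal)
    (le_antisymm (opSeminorm_toReal_le le_rfl fun x => by
      change modSem F p 0 ≤ _
      simp) ENNReal.toReal_nonneg)
    (fun T S => opSeminorm_toReal_le (by positivity) fun x => by
      rw [add_mul]
      exact (map_add_le_add _ _ _).trans
        (add_le_add (le_opSeminorm_toReal p T x) (le_opSeminorm_toReal p S x)))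
    (fun z T => opSeminorm_toReal_le (by positivity) fun x => by
      change modSem F p (z • T.toLin x) ≤ _
      rw [map_smul_eq_mul, mul_assoc]
      gcongr
      exact le_opSeminorm_toReal p T x)

theorem ofReal_opSem (p : CStarSeminorms A) (T : Adjointable A E F) :
    ENNReal.ofReal (opSem p T) = opSeminorm p T :=
  ENNReal.ofReal_toReal (opSeminorm_ne_top p T)

theorem le_opSem (p : CStarSeminorms A) (T : Adjointable A E F) (x : E) :
    modSem F p (T.toLin x) ≤ opSem p T * modSem E p x :=
  le_opSeminorm_toReal p T x

theorem opSem_le {p : CStarSeminorms A} {T : Adjointable A E F} {C : ℝ} (hC : 0 ≤ C)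
    (h : ∀ x, modSem F p (T.toLin x) ≤ C * modSem E p x) : opSem p T ≤ C :=
  opSeminorm_toReal_le hC h

theorem opSem_adjoint_le (p : CStarSeminorms A) (T : Adjointable A E F) :
    opSem p T.adjoint ≤ opSem p T := by
  refine opSem_le (apply_nonneg _ _) fun y => ?_
  refine modSem_le_of_inner_le p (by positivity) ?_
  change p.1 (inner A (T.adj y) (T.adj y)) ≤ opSem p T * _ * modSem E p (T.adj y)
  rw [← T.inner_eq, mul_right_comm]
  refine (inner_le p _ _).trans ?_
  gcongr
  exact le_opSem p T _

theorem opSem_comp_le (p : CStarSeminorms A) (T : Adjointable A F G) (S : Adjointable A E F) :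
    opSem p (T.comp S) ≤ opSem p T * opSem p S :=
  opSem_le (by positivity) fun x => (le_opSem p T _).trans (by
    rw [mul_assoc]; gcongr; exact le_opSem p S x)

theorem opSem_adjoint_comp_self (p : CStarSeminorms A) (T : Adjointable A E F) :
    opSem p (T.adjoint.comp T) = opSem p T ^ 2 := by
  refine le_antisymm ((opSem_comp_le p _ _).trans ?_) ?_
  · rw [sq]; gcongr; exact opSem_adjoint_le p T
  · have h1 : opSem p T ≤ √(opSem p (T.adjoint.comp T)) := by
      refine opSem_le (Real.sqrt_nonneg _) fun x => ?_
      refine (pow_le_pow_iff_left₀ (apply_nonneg _ _) (by positivity) two_ne_zero).1 ?_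
      rw [mul_pow, Real.sq_sqrt (apply_nonneg _ _), modSem_sq, T.inner_eq]
      refine (inner_le p _ _).trans ?_
      rw [sq, ← mul_assoc, mul_comm]
      gcongr
      exact le_opSem p (T.adjoint.comp T) x
    exact (Real.le_sqrt (apply_nonneg _ _) (apply_nonneg _ _)).1 h1

theorem isCStarSeminorm_opSem (p : CStarSeminorms A) :
    IsCStarSeminorm (opSem (E := E) (F := E) p) :=
  ⟨opSem_comp_le p, opSem_adjoint_comp_self p⟩

/-- The topology of `L_A(E, F)` is given by the seminorms `p̃`. -/
theorem withSeminorms_opSem :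
    WithSeminorms (fun p : CStarSeminorms A => opSem (E := E) (F := F) p) := by
  refine withSeminorms_of_eq_generateFrom _ ?_
  simp only [ofReal_opSem]
  rfl

/-- An adjointable operator is determined by its underlying map. -/
theorem ext_toLin {T S : Adjointable A E F} (h : ∀ x, T.toLin x = S.toLin x) : T = S := by
  refine ext' h fun y => sub_eq_zero.1 (IsHilbertModule.inner_self_eq_zero (A := A) _ ?_)
  rw [inner_sub_right, ← T.inner_eq, ← S.inner_eq, h, sub_self]

theorem opSem_separating {T : Adjointable A E F} (h : ∀ p : CStarSeminorms A, opSem p T = 0) :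
    T = 0 := by
  refine ext_toLin fun x => modSem_eq_zero (A := A) fun p => ?_
  refine le_antisymm ?_ (apply_nonneg _ _)
  have := le_opSem p T x
  rwa [h p, zero_mul] at this

/-- `L_A(E, F)` is complete for the seminorms `p̃`. -/
theorem complete_opSem : IsCompleteFor fun (p : CStarSeminorms A) (T : Adjointable A E F) =>
    opSem p T := by
  intro l hl hc
  dsimp only at hc
  -- Both `T ↦ T x` and `T ↦ T* y` map `l` to Cauchy filters.
  have h1 : ∀ x : E, ∃ z : F, ModTendsto A (fun T : Adjointable A E F => T.toLin x) l z := by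
    intro x
    obtain ⟨z, hz⟩ := exists_modTendsto (A := A)
      (l := map (fun T : Adjointable A E F => T.toLin x) l) (by
        intro p ε hε
        obtain ⟨s, hs, h⟩ := hc p (ε / (modSem E p x + 1)) (by positivity)
        refine ⟨_, image_mem_map hs, ?_⟩
        rintro _ ⟨T, hT, rfl⟩ _ ⟨S, hS, rfl⟩
        have h2 := h T hT S hS
        rw [lt_div_iff₀ (by positivity)] at h2
        have h3 := le_opSem p (T - S) x
        have h4 := apply_nonneg (opSem (E := E) (F := F) p) (T - S)
        have h5 : (T - S).toLin x = T.toLin x - S.toLin x := (sub_eq_add_neg _ _).symm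
        rw [h5] at h3
        dsimp only
        linarith)
    exact ⟨z, fun p => tendsto_map'_iff.1 (hz p)⟩
  have h2 : ∀ y : F, ∃ z : E, ModTendsto A (fun T : Adjointable A E F => T.adj y) l z := by
    intro x
    obtain ⟨z, hz⟩ := exists_modTendsto (A := A)
      (l := map (fun T : Adjointable A E F => T.adj x) l) (by
        intro p ε hε
        obtain ⟨s, hs, h⟩ := hc p (ε / (modSem F p x + 1)) (by positivity)
        refine ⟨_, image_mem_map hs, ?_⟩
        rintro _ ⟨T, hT, rfl⟩ _ ⟨S, hS, rfl⟩
        have h2 := h T hT S hS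
        rw [lt_div_iff₀ (by positivity)] at h2
        have h3 := le_opSem p (T - S).adjoint x
        have h4 := apply_nonneg (opSem (E := E) (F := F) p) (T - S)
        have h5 : (T - S).adjoint.toLin x = T.adj x - S.adj x := (sub_eq_add_neg _ _).symm
        rw [h5] at h3
        have h6 := mul_le_mul_of_nonneg_right (opSem_adjoint_le p (T - S))
          (apply_nonneg (modSem F p) x)
        dsimp only
        linarith)
    exact ⟨z, fun p => tendsto_map'_iff.1 (hz p)⟩
  choose f hf using h1
  choose g hg using h2
  let R : Adjointable A E F :=
    { toLin :=
        { toFun := f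
          map_add' := fun x y => (hf (x + y)).unique
            (((hf x).add (hf y)).congr fun T => (map_add _ _ _).symm)
          map_smul' := fun z x => (hf (z • x)).unique
            (((hf x).const_smul z).congr fun T => (map_smul _ _ _).symm) }
      adj :=
        { toFun := g
          map_add' := fun x y => (hg (x + y)).unique
            (((hg x).add (hg y)).congr fun T => (map_add _ _ _).symm)
          map_smul' := fun z x => (hg (z • x)).unique
            (((hg x).const_smul z).congr fun T => (map_smul _ _ _).symm) }
      map_op_smul := fun a x => (hf (op a • x)).unique
        (((hf x).op_smul a).congr fun T => (T.map_op_smul a x).symm)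
      adj_op_smul := fun a x => (hg (op a • x)).unique
        (((hg x).op_smul a).congr fun T => (T.adj_op_smul a x).symm)
      inner_eq := fun x y => ((hf x).inner_left y).unique
        (((hg y).inner_right x).congr fun T => (T.inner_eq x y).symm) }
  refine ⟨R, fun p => ?_⟩
  rw [Metric.tendsto_nhds]
  intro ε hε
  obtain ⟨s, hs, h⟩ := hc p (ε / 2) (half_pos hε)
  filter_upwards [hs] with T hT
  rw [dist_zero_right, Real.norm_of_nonneg (apply_nonneg _ _)]
  refine lt_of_le_of_lt (opSem_le (half_pos hε).le fun x => ?_) (half_lt_self hε)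
  have h3 : ModTendsto A (fun S : Adjointable A E F => T.toLin x - S.toLin x) l
      (T.toLin x - f x) := (hf x).of_le fun p => ⟨1, fun S => by
    rw [sub_sub_sub_cancel_left, map_sub_rev, one_mul]⟩
  have h4 : (T - R).toLin x = T.toLin x - f x := (sub_eq_add_neg _ _).symm
  rw [h4]
  refine h3.norm_le p ?_
  filter_upwards [hs] with S hS
  have h5 : (T - S).toLin x = T.toLin x - S.toLin x := (sub_eq_add_neg _ _).symm
  rw [← h5]
  exact (le_opSem p (T - S) x).trans (by gcongr; exact (h T hT S hS).le)

theorem continuous_opSem (p : CStarSeminorms A) :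
    Continuous (opSem p : Adjointable A E F → ℝ) :=
  withSeminorms_opSem.continuous_seminorm p

/-- `p̃` as a continuous C*-seminorm on `L_A(E)`. -/
noncomputable def opCStarSeminorm (p : CStarSeminorms A) : CStarSeminorms (Adjointable A E E) :=
  ⟨opSem p, isCStarSeminorm_opSem p, continuous_opSem p⟩

theorem tendsto_of_opSem {l : Filter (Adjointable A E F)} {T : Adjointable A E F}
    (h : ∀ p : CStarSeminorms A, Tendsto (fun S => opSem p (S - T)) l (𝓝 0)) : l ≤ 𝓝 T := by
  have : Tendsto (fun S => S) l (𝓝 T) := by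
    rw [withSeminorms_opSem.tendsto_nhds]
    exact fun p ε hε => (h p).eventually (gt_mem_nhds hε)
  exact this

/-- `L_A(E)` is a locally C*-algebra. -/
instance locallyCStarAlgebra : LocallyCStarAlgebra (Adjointable A E E) where
  t2 := by
    have _ : IsTopologicalAddGroup (Adjointable A E E) :=
      (withSeminorms_opSem (E := E) (F := E)).topologicalAddGroup
    have _ : T1Space (Adjointable A E E) :=
      (withSeminorms_opSem (E := E) (F := E)).T1_of_separating fun T hT => by
        by_contra! h
        exact hT (opSem_separating h)
    infer_instance
  withSeminorms := by
    refine (withSeminorms_opSem (E := E) (F := E)).congr ?_ ?_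
    · intro r
      obtain ⟨s, C, hC, h⟩ := Seminorm.bound_of_continuous withSeminorms_opSem r.1 r.2.2
      exact ⟨s, C, h⟩
    · intro p
      refine ⟨{opCStarSeminorm p}, 1, ?_⟩
      rw [Finset.sup_singleton, one_smul]
      exact le_rfl
  complete := by
    intro l hl h
    obtain ⟨T, hT⟩ := complete_opSem l hl fun p => h (opCStarSeminorm p)
    refine ⟨T, fun r => ?_⟩
    have _ : IsTopologicalAddGroup (Adjointable A E E) :=
      (withSeminorms_opSem (E := E) (F := E)).topologicalAddGroup
    have h1 : Tendsto (fun S => r.1 (S - T)) (𝓝 T) (𝓝 (r.1 (T - T))) :=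
      (r.2.2.comp (continuous_id.sub continuous_const)).tendsto T
    rw [sub_self, map_zero] at h1
    exact h1.mono_left (tendsto_of_opSem hT)

end Adjointable

end operators

/-! ### Multiplier modules as Hilbert modules -/

section multiplierModule

variable {A : Type u} [NonUnitalRing A] [StarRing A] [Module ℂ A] [IsScalarTower ℂ A A]
  [SMulCommClass ℂ A A] [StarModule ℂ A] [TopologicalSpace A] [LocallyCStarAlgebra A]
  {E : Type v} [AddCommGroup E] [Module ℂ E] [SMul Aᵐᵒᵖ E] [Inner A E] [IsHilbertModule A E]

instance MultiplierModule.hermitianModule :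
    HermitianModule (MultiplierAlg A) (MultiplierModule A E) where
  op_smul_add _ _ _ := Adjointable.ext_toLin fun _ => rfl
  add_op_smul m n t := Adjointable.ext_toLin fun a => map_add t.toLin (m.toLin a) (n.toLin a)
  mul_op_smul _ _ _ := Adjointable.ext_toLin fun _ => rfl
  smul_op_smul z m t := Adjointable.ext_toLin fun a => map_smul t.toLin z (m.toLin a)
  op_smul_smul _ _ _ := Adjointable.ext_toLin fun _ => rfl
  inner_add_right s t r := Adjointable.ext_toLin fun a => map_add s.adj (t.toLin a) (r.toLin a)
  inner_smul_right z s t := Adjointable.ext_toLin fun a => map_smul s.adj z (t.toLin a)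
  inner_op_smul_right _ _ _ := Adjointable.ext_toLin fun _ => rfl
  star_inner _ _ := Adjointable.ext_toLin fun _ => rfl

theorem inner_multiplier_apply (s t : MultiplierModule A E) (a : A) :
    (inner (MultiplierAlg A) s t).toLin a = s.adj (t.toLin a) := rfl

/-- The element `t* t` of `M(A)` is positive: if `t* t = b² - c²` with selfadjoint `b`, `c` such that
`b c = 0`, then `⟨t c a, t c a⟩ + ⟨c² a, c² a⟩ = 0` for all `a`, hence `c = 0`. -/
theorem exists_adjoint_comp_self_eq (t : MultiplierModule A E) :
    ∃ b : MultiplierAlg A, inner (MultiplierAlg A) t t = star b * b := by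
  obtain ⟨b, c, hb, hc, e, hbc, hcb⟩ := exists_sq_sub_sq
    (HermitianModule.star_inner (A := MultiplierAlg A) t t)
  have hcadj : ∀ a, c.adj a = c.toLin a := fun a => by
    conv_rhs => rw [← hc]
    rfl
  have hbc' : ∀ a, b.toLin (c.toLin a) = 0 := fun a => by
    change (b * c).toLin a = 0
    rw [hbc]; rfl
  have hcc : ∀ a, c.toLin (c.toLin a) = 0 := fun a => by
    have h1 : t.adj (t.toLin (c.toLin a)) = -c.toLin (c.toLin (c.toLin a)) := by
      rw [← inner_multiplier_apply, e]
      change b.toLin (b.toLin (c.toLin a)) + -(c.toLin (c.toLin (c.toLin a))) = _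
      rw [hbc', map_zero, zero_add]
    have h2 : inner A (t.toLin (c.toLin a)) (t.toLin (c.toLin a)) =
        -inner A (c.toLin (c.toLin a)) (c.toLin (c.toLin a)) := by
      rw [t.inner_eq, h1, HermitianModule.inner_neg_right, c.inner_eq (c.toLin a), hcadj]
    have h3 := locallyNonneg_inner_self (A := A) (t.toLin (c.toLin a))
    rw [h2] at h3
    exact IsHilbertModule.inner_self_eq_zero (A := A) _ ((locallyNonneg_inner_self _).eq_zero h3)
  have hc0 : c * c = 0 := Adjointable.ext_toLin hcc
  exact ⟨b, by rw [e, hc0, sub_zero, hb]⟩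

theorem tendsto_modSeminorm_of_opSem (r : CStarSeminorms (MultiplierAlg A))
    {l : Filter (MultiplierModule A E)} {t : MultiplierModule A E}
    (h : ∀ p : CStarSeminorms A, Tendsto (fun s => Adjointable.opSem p (s - t)) l (𝓝 0)) :
    Tendsto (fun s => modSeminorm (A := MultiplierAlg A) (MultiplierModule A E) r (s - t)) l
      (𝓝 0) := by
  have h1 : Tendsto (fun s => inner (MultiplierAlg A) (s - t) (s - t)) l (𝓝 0) := by
    have : map (fun s => inner (MultiplierAlg A) (s - t) (s - t)) l ≤ 𝓝 0 := by
      refine Adjointable.tendsto_of_opSem fun p => ?_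
      rw [tendsto_map'_iff]
      have h2 := (h p).pow 2
      rw [zero_pow two_ne_zero] at h2
      refine h2.congr fun s => ?_
      rw [← Adjointable.opSem_adjoint_comp_self, Function.comp_apply, sub_zero]
      rfl
    exact this
  have h3 := ((Real.continuous_sqrt.comp r.2.2).tendsto 0).comp h1
  rwa [Function.comp_apply, map_zero, Real.sqrt_zero] at h3

/-- `M(E) = L_A(A, E)` is a Hilbert `M(A)`-module. -/
instance MultiplierModule.isHilbertModule :
    IsHilbertModule (MultiplierAlg A) (MultiplierModule A E) where
  inner_self_nonneg := exists_adjoint_comp_self_eq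
  inner_self_eq_zero t ht := Adjointable.ext_toLin fun a => by
    refine IsHilbertModule.inner_self_eq_zero (A := A) _ ?_
    rw [t.inner_eq, ← inner_multiplier_apply, ht]
    exact HermitianModule.inner_zero_right a
  complete := by
    intro l hl h
    have h1 : ∀ (p : CStarSeminorms A) (t : MultiplierModule A E),
        modSeminorm (A := MultiplierAlg A) (MultiplierModule A E)
          (Adjointable.opCStarSeminorm p) t = Adjointable.opSem p t := fun p t => by
      change √(Adjointable.opSem p (t.adjoint.comp t)) = _
      rw [Adjointable.opSem_adjoint_comp_self, Real.sqrt_sq (apply_nonneg _ _)]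
    obtain ⟨t, ht⟩ := Adjointable.complete_opSem l hl fun p => by
      simpa only [h1] using h (Adjointable.opCStarSeminorm p)
    exact ⟨t, fun r => tendsto_modSeminorm_of_opSem r ht⟩

end multiplierModule

/-! ### Direct sums of Hilbert modules -/

section hilbertSumModule

variable {A : Type u} [NonUnitalRing A] [StarRing A] [Module ℂ A] [IsScalarTower ℂ A A]
  [SMulCommClass ℂ A A] [StarModule ℂ A] [TopologicalSpace A] [LocallyCStarAlgebra A]
  {E : ℕ → Type v} [∀ n, AddCommGroup (E n)] [∀ n, Module ℂ (E n)]
  [∀ n, SMul Aᵐᵒᵖ (E n)] [∀ n, Inner A (E n)] [∀ n, IsHilbertModule A (E n)]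

theorem LocallyNonneg.sum {ι : Type*} {J : Finset ι} {x : ι → A}
    (h : ∀ i ∈ J, LocallyNonneg (x i)) : LocallyNonneg (∑ i ∈ J, x i) := by
  intro p B _ _ _ f hf
  rw [map_sum]
  exact Finset.sum_nonneg fun i hi => h i hi p B f hf

theorem LocallyNonneg.of_tendsto {ι : Type*} {l : Filter ι} [l.NeBot] {f : ι → A} {a : A}
    (h : Tendsto f l (𝓝 a)) (hf : ∀ᶠ i in l, LocallyNonneg (f i)) : LocallyNonneg a := by
  intro p B _ _ _ φ hφ
  have h1 : Tendsto (fun i => φ (f i)) l (𝓝 (φ a)) := by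
    rw [tendsto_iff_norm_sub_tendsto_zero]
    exact (ModTendsto.of_tendsto h p).congr fun i => by rw [modSem_self, ← hφ, map_sub]
  refine CStarAlgebra.isClosed_nonneg.mem_of_tendsto h1 ?_
  filter_upwards [hf] with i hi using hi p B φ hφ

theorem LocallyNonneg.seminorm_le {a b : A} (ha : LocallyNonneg a) (hab : LocallyNonneg (b - a))
    (p : CStarSeminorms A) : p.1 a ≤ p.1 b := by
  obtain ⟨B, _, _, _, f, hf⟩ := p.2.1.exists_ordered_hom
  rw [← hf, ← hf]
  refine CStarAlgebra.norm_le_norm_of_nonneg_of_le (ha p B f hf) ?_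
  rw [← sub_nonneg, ← map_sub]
  exact hab p B f hf

theorem locallyNonneg_sum_inner (J : Finset ℕ) (x : ∀ n, E n) :
    LocallyNonneg (∑ k ∈ J, inner A (x k) (x k)) :=
  LocallyNonneg.sum fun _ _ => locallyNonneg_inner_self _

/-- Finite partial sums of a convergent series `∑ ⟨x_k, x_k⟩` are bounded by its limit. -/
theorem seminorm_sum_inner_le {x : ∀ n, E n} {l : A}
    (h : Tendsto (fun n => ∑ k ∈ Finset.range n, inner A (x k) (x k)) atTop (𝓝 l))
    (J : Finset ℕ) (p : CStarSeminorms A) : p.1 (∑ k ∈ J, inner A (x k) (x k)) ≤ p.1 l := by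
  have _ : IsTopologicalAddGroup A := LocallyCStarAlgebra.withSeminorms.topologicalAddGroup
  refine (locallyNonneg_sum_inner J x).seminorm_le ?_ p
  refine LocallyNonneg.of_tendsto (h.sub_const _) ?_
  obtain ⟨N, hN⟩ := J.exists_nat_subset_range
  filter_upwards [eventually_ge_atTop N] with n hn
  rw [← Finset.sum_sdiff_eq_sub (hN.trans (Finset.range_subset_range.2 hn))]
  exact locallyNonneg_sum_inner _ x

theorem HilbertSum.locallyNonneg_inner_self (x : HilbertSum A E) :
    LocallyNonneg (inner A x x) :=
  LocallyNonneg.of_tendsto (HilbertSum.inner_tendsto x x)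
    (Eventually.of_forall fun _ => locallyNonneg_sum_inner _ _)

theorem HilbertSum.familySeminorm_le (p : CStarSeminorms A) (J : Finset ℕ) (x : HilbertSum A E) :
    familySeminorm p.2.1 J x.1 ≤ modSeminorm (HilbertSum A E) p x :=
  Real.sqrt_le_sqrt (seminorm_sum_inner_le (HilbertSum.inner_tendsto x x) J p)

theorem HilbertSum.modSeminorm_le {p : CStarSeminorms A} {x : HilbertSum A E} {C : ℝ}
    (h : ∀ n : ℕ, familySeminorm p.2.1 (Finset.range n) x.1 ≤ C) :
    modSeminorm (HilbertSum A E) p x ≤ C := by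
  have hC : 0 ≤ C := (apply_nonneg _ _).trans (h 0)
  refine Real.sqrt_le_iff.2 ⟨hC, ?_⟩
  rw [← modSem_self]
  refine (ModTendsto.of_tendsto (HilbertSum.inner_tendsto x x)).norm_le p
    (Eventually.of_forall fun n => ?_)
  rw [modSem_self, ← familySeminorm_sq p.2.1]
  have := h n
  gcongr

theorem familySeminorm_singleton (p : CStarSeminorms A) (k : ℕ) (x : ∀ n, E n) :
    familySeminorm p.2.1 {k} x = modSem (E k) p (x k) := by
  rw [familySeminorm_apply, Finset.sum_singleton, modSem_apply]

theorem familySeminorm_le_sum (p : CStarSeminorms A) (J : Finset ℕ) (x : ∀ n, E n) :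
    familySeminorm p.2.1 J x ≤ ∑ k ∈ J, modSem (E k) p (x k) := by
  refine Real.sqrt_le_iff.2 ⟨Finset.sum_nonneg fun _ _ => apply_nonneg _ _, ?_⟩
  refine (Finset.le_sum_of_subadditive p.1 (map_zero _).le (map_add_le_add _) _ _).trans ?_
  simp only [← modSem_sq]
  exact Finset.sum_sq_le_sq_sum_of_nonneg fun _ _ => apply_nonneg _ _

theorem squareSummable_of_familySeminorm {x : ∀ n, E n}
    (h : ∀ p : CStarSeminorms A, ∀ ε > 0, ∃ N, ∀ n ≥ N, ∀ m ≥ n,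
      familySeminorm p.2.1 (Finset.Ico n m) x < ε) : SquareSummable A x := by
  refine tendsto_of_cauchy fun p ε hε => ?_
  obtain ⟨N, hN⟩ := h p (√ε) (Real.sqrt_pos.2 hε)
  exact ⟨N, fun n hn m hm => (Real.sqrt_lt_sqrt_iff (apply_nonneg _ _)).1 (hN n hn m hm)⟩

theorem SquareSummable.familySeminorm_lt {x : ∀ n, E n} (hx : SquareSummable A x)
    (p : CStarSeminorms A) {ε : ℝ} (hε : 0 < ε) : ∃ N, ∀ n ≥ N, ∀ m ≥ n,
      familySeminorm p.2.1 (Finset.Ico n m) x < ε := by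
  obtain ⟨l, hl⟩ := hx
  obtain ⟨N, hN⟩ := cauchy_of_tendsto hl p (ε ^ 2) (by positivity)
  exact ⟨N, fun n hn m hm => (Real.sqrt_lt' hε).2 (hN n hn m hm)⟩

/-- Coordinatewise limits of Cauchy filters in the direct sum satisfy the Cauchy estimate. -/
theorem familySeminorm_sub_le {l : Filter (HilbertSum A E)} [l.NeBot] {z : ∀ n, E n}
    (hz : ∀ k, ModTendsto A (fun x : HilbertSum A E => x.1 k) l (z k)) (p : CStarSeminorms A)
    {ε : ℝ} {s : Set (HilbertSum A E)} (hs : s ∈ l)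
    (h : ∀ x ∈ s, ∀ y ∈ s, modSeminorm (HilbertSum A E) p (x - y) < ε)
    {x : HilbertSum A E} (hx : x ∈ s) (J : Finset ℕ) : familySeminorm p.2.1 J (x.1 - z) ≤ ε := by
  have h1 : Tendsto (fun y : HilbertSum A E => familySeminorm p.2.1 J (y.1 - z)) l (𝓝 0) := by
    refine squeeze_zero (fun _ => apply_nonneg _ _) (fun y => familySeminorm_le_sum p J _) ?_
    rw [← Finset.sum_const_zero (s := J)]
    exact tendsto_finsetSum _ fun k _ => hz k p
  have h2 := h1.const_add ε
  rw [add_zero] at h2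
  refine ge_of_tendsto h2 ?_
  filter_upwards [hs] with y hy
  have h3 := map_add_le_add (familySeminorm p.2.1 J) (x.1 - y.1) (y.1 - z)
  rw [sub_add_sub_cancel] at h3
  exact h3.trans (by
    gcongr
    exact (HilbertSum.familySeminorm_le p J (x - y)).trans (h x hx y hy).le)

/-- The direct sum of Hilbert `A`-modules is a Hilbert `A`-module. -/
instance HilbertSum.isHilbertModule : IsHilbertModule A (HilbertSum A E) where
  inner_self_nonneg x := (HilbertSum.locallyNonneg_inner_self x).exists_star_mul_self
  inner_self_eq_zero x hx := by
    refine Subtype.ext (funext fun k => modSem_eq_zero (A := A) fun p => ?_)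
    refine le_antisymm ?_ (apply_nonneg _ _)
    have h := HilbertSum.familySeminorm_le p {k} x
    rwa [familySeminorm_singleton, modSeminorm, hx, map_zero, Real.sqrt_zero] at h
  complete := by
    intro l hl h
    have h1 : ∀ k, ∃ z : E k, ModTendsto A (fun x : HilbertSum A E => x.1 k) l z := by
      intro k
      obtain ⟨z, hz⟩ := exists_modTendsto (A := A)
        (l := map (fun x : HilbertSum A E => x.1 k) l) (by
          intro p ε hε
          obtain ⟨s, hs, h2⟩ := h p ε hε
          refine ⟨_, image_mem_map hs, ?_⟩
          rintro _ ⟨x, hx, rfl⟩ _ ⟨y, hy, rfl⟩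
          have h3 := HilbertSum.familySeminorm_le p {k} (x - y)
          rw [familySeminorm_singleton] at h3
          exact h3.trans_lt (h2 x hx y hy))
      exact ⟨z, fun p => tendsto_map'_iff.1 (hz p)⟩
    choose z hz using h1
    have hzs : SquareSummable A z := squareSummable_of_familySeminorm fun p ε hε => by
      obtain ⟨s, hs, h2⟩ := h p (ε / 2) (half_pos hε)
      obtain ⟨x, hx⟩ := nonempty_of_mem hs
      obtain ⟨N, hN⟩ := x.2.familySeminorm_lt p (half_pos hε)
      refine ⟨N, fun n hn m hm => ?_⟩
      have h3 := familySeminorm_sub_le hz p hs h2 hx (Finset.Ico n m)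
      have h4 := map_sub_le_add (familySeminorm p.2.1 (Finset.Ico n m)) x.1 (x.1 - z)
      rw [sub_sub_cancel] at h4
      linarith [hN n hn m hm]
    refine ⟨⟨z, hzs⟩, fun p => ?_⟩
    rw [Metric.tendsto_nhds]
    intro ε hε
    obtain ⟨s, hs, h2⟩ := h p (ε / 2) (half_pos hε)
    filter_upwards [hs] with x hx
    rw [dist_zero_right]
    refine (Real.norm_of_nonneg (Real.sqrt_nonneg _)).trans_lt ?_
    exact (HilbertSum.modSeminorm_le fun n =>
      familySeminorm_sub_le hz p hs h2 hx (Finset.range n)).trans_lt (half_lt_self hε)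

end hilbertSumModule

/-! ### Transport of structure and strict direct sums -/

section transport

variable {A : Type u} [NonUnitalRing A] [StarRing A] [Module ℂ A] [TopologicalSpace A]
  {E : Type v} [AddCommGroup E] [Module ℂ E] [SMul Aᵐᵒᵖ E] [Inner A E]
  {F : Type w} [AddCommGroup F] [Module ℂ F] [SMul Aᵐᵒᵖ F] [Inner A F] [IsHilbertModule A F]

/-- A linear bijection that preserves the action and the inner product transports the Hilbert module
structure. -/
theorem isHilbertModule_of_linearEquiv (e : E ≃ₗ[ℂ] F)
    (hs : ∀ (a : A) (x : E), e (op a • x) = op a • e x)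
    (hi : ∀ x y : E, inner A (e x) (e y) = inner A x y) : IsHilbertModule A E where
  op_smul_add a x y := e.injective (by simp only [hs, map_add, HermitianModule.op_smul_add])
  add_op_smul a b x := e.injective (by simp only [hs, map_add, HermitianModule.add_op_smul])
  mul_op_smul a b x := e.injective (by simp only [hs, HermitianModule.mul_op_smul])
  smul_op_smul z a x := e.injective (by simp only [hs, map_smul, HermitianModule.smul_op_smul])
  op_smul_smul z a x := e.injective (by simp only [hs, map_smul, HermitianModule.op_smul_smul])
  inner_add_right x y z := by simp only [← hi, map_add, HermitianModule.inner_add_right]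
  inner_smul_right z x y := by simp only [← hi, map_smul, HermitianModule.inner_smul_right]
  inner_op_smul_right a x y := by simp only [← hi, hs, HermitianModule.inner_op_smul_right]
  star_inner x y := by simp only [← hi, HermitianModule.star_inner]
  inner_self_nonneg x := by rw [← hi]; exact IsHilbertModule.inner_self_nonneg _
  inner_self_eq_zero x hx := e.injective (by
    rw [map_zero]
    exact IsHilbertModule.inner_self_eq_zero (A := A) _ ((hi x x).trans hx))
  complete := by
    have hn : ∀ (p : CStarSeminorms A) (x y : E),
        modSeminorm E p (x - y) = modSeminorm F p (e x - e y) := fun p x y => by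
      rw [modSeminorm, modSeminorm, ← map_sub, hi]
    intro l hl h
    obtain ⟨y, hy⟩ := IsHilbertModule.complete (A := A) (E := F) (map e l) inferInstance (by
      intro p ε hε
      obtain ⟨s, hs, h'⟩ := h p ε hε
      refine ⟨_, image_mem_map hs, ?_⟩
      rintro _ ⟨x, hx, rfl⟩ _ ⟨y, hy, rfl⟩
      rw [← hn]
      exact h' x hx y hy)
    refine ⟨e.symm y, fun p => (tendsto_map'_iff.1 (hy p)).congr fun x => ?_⟩
    rw [hn, e.apply_symm_apply]
    rfl

theorem unitarilyEquivalent_of_linearEquiv (e : E ≃ₗ[ℂ] F)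
    (hs : ∀ (a : A) (x : E), e (op a • x) = op a • e x)
    (hi : ∀ x y : E, inner A (e x) (e y) = inner A x y) : UnitarilyEquivalent A E F :=
  ⟨⟨e.toLinearMap, e.symm.toLinearMap, hs,
    fun a y => e.injective (by simp [hs]), fun x y => by
      rw [← hi x]; simp⟩, e.symm_apply_apply, e.apply_symm_apply⟩

end transport

section strictSum

variable {A : Type u} [NonUnitalRing A] [StarRing A] [Module ℂ A] [IsScalarTower ℂ A A]
  [SMulCommClass ℂ A A] [StarModule ℂ A] [TopologicalSpace A] [LocallyCStarAlgebra A]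

theorem inner_sum_right {ι : Type*} {E : Type v} [AddCommGroup E] [Module ℂ E] [SMul Aᵐᵒᵖ E]
    [Inner A E] [IsHilbertModule A E] (J : Finset ι) (x : E) (y : ι → E) :
    inner A x (∑ k ∈ J, y k) = ∑ k ∈ J, inner A x (y k) :=
  map_sum (⟨⟨fun y => inner A x y, HermitianModule.inner_zero_right x⟩,
    HermitianModule.inner_add_right x⟩ : E →+ A) y J

namespace Adjointable

variable {E : Type v} [AddCommGroup E] [Module ℂ E] [SMul Aᵐᵒᵖ E] [Inner A E] [IsHilbertModule A E]
  {F : Type w} [AddCommGroup F] [Module ℂ F] [SMul Aᵐᵒᵖ F] [Inner A F] [IsHilbertModule A F]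

theorem sum_toLin {ι : Type*} (J : Finset ι) (T : ι → Adjointable A E F) (x : E) :
    (∑ k ∈ J, T k).toLin x = ∑ k ∈ J, (T k).toLin x :=
  map_sum (⟨⟨fun T => T.toLin x, rfl⟩, fun _ _ => rfl⟩ : Adjointable A E F →+ F) T J

theorem sum_adj {ι : Type*} (J : Finset ι) (T : ι → Adjointable A E F) (y : F) :
    (∑ k ∈ J, T k).adj y = ∑ k ∈ J, (T k).adj y :=
  map_sum (⟨⟨fun T => T.adj y, rfl⟩, fun _ _ => rfl⟩ : Adjointable A E F →+ E) T J

/-- Strict convergence is pointwise convergence of the operators and of their adjoints. -/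
theorem strictTendsto_iff {ι : Type*} {l : Filter ι} {f : ι → MultiplierModule A E}
    {t : MultiplierModule A E} : StrictTendsto f l t ↔
      (∀ a, ModTendsto A (fun i => (f i).toLin a) l (t.toLin a)) ∧
      ∀ x, ModTendsto A (fun i => (f i).adj x) l (t.adj x) := by
  have h1 : ∀ (i : ι) (a : A), (f i).toLin a - t.toLin a = (f i - t).toLin a := fun i a => by
    rw [sub_eq_add_neg, sub_eq_add_neg]; rfl
  have h2 : ∀ (i : ι) (x : E), (f i).adj x - t.adj x = (f i - t).adj x := fun i x => by
    rw [sub_eq_add_neg, sub_eq_add_neg]; rfl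
  simp only [StrictTendsto, ModTendsto, strictSeminorm, h1, h2, modSeminorm_eq, modSem_self]
  refine ⟨fun h => ⟨fun a p => ?_, fun x p => ?_⟩, fun h p a x => ?_⟩
  · exact squeeze_zero (fun _ => apply_nonneg _ _)
      (fun i => le_add_of_nonneg_right (apply_nonneg _ _)) (h p a 0)
  · exact squeeze_zero (fun _ => apply_nonneg _ _)
      (fun i => le_add_of_nonneg_left (apply_nonneg _ _)) (h p 0 x)
  · simpa using (h.1 a p).add (h.2 x p)

end Adjointable

variable {E : ℕ → Type v} [∀ n, AddCommGroup (E n)] [∀ n, Module ℂ (E n)]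
  [∀ n, SMul Aᵐᵒᵖ (E n)] [∀ n, Inner A (E n)] [∀ n, IsHilbertModule A (E n)]

theorem sum_inner_single (x : ∀ n, E n) (k n : ℕ) (y : E k) (hn : k < n) :
    ∑ j ∈ Finset.range n, inner A (x j) ((Pi.single k y : ∀ n, E n) j) = inner A (x k) y := by
  rw [Finset.sum_eq_single_of_mem k (Finset.mem_range.2 hn), Pi.single_eq_same]
  intro j _ hj
  rw [Pi.single_eq_of_ne hj, HermitianModule.inner_zero_right]

theorem squareSummable_single (k : ℕ) (y : E k) : SquareSummable A (Pi.single k y : ∀ n, E n) := by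
  refine ⟨inner A y y, tendsto_const_nhds.congr' ?_⟩
  filter_upwards [eventually_gt_atTop k] with n hn
  rw [sum_inner_single _ k n y hn, Pi.single_eq_same]

/-- The coordinate projection `⨁ E_n → E_k`; its adjoint is the inclusion. -/
def HilbertSum.proj (k : ℕ) : Adjointable A (HilbertSum A E) (E k) where
  toLin := LinearMap.proj k ∘ₗ (squareSummable A E).subtype
  adj := LinearMap.codRestrict (squareSummable A E) (LinearMap.single ℂ E k) (squareSummable_single k)
  map_op_smul _ _ := rfl
  adj_op_smul a y := Subtype.ext (funext fun j => by
    change (Pi.single k (op a • y) : ∀ n, E n) j = op a • (Pi.single k y : ∀ n, E n) j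
    rcases eq_or_ne j k with rfl | hj
    · rw [Pi.single_eq_same, Pi.single_eq_same]
    · rw [Pi.single_eq_of_ne hj, Pi.single_eq_of_ne hj, HermitianModule.op_smul_zero])
  inner_eq x y := by
    have _ : T2Space A := LocallyCStarAlgebra.t2
    refine tendsto_nhds_unique (tendsto_const_nhds.congr' ?_) (HilbertSum.inner_tendsto x _)
    filter_upwards [eventually_gt_atTop k] with n hn
    exact (sum_inner_single x.1 k n y hn).symm

/-- The truncations of an element of the direct sum converge to it. -/
theorem HilbertSum.modTendsto_truncation (x : HilbertSum A E) :
    ModTendsto A (fun n => ∑ k ∈ Finset.range n, (HilbertSum.proj k).adj (x.1 k)) atTop x := by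
  intro p
  rw [Metric.tendsto_nhds]
  intro ε hε
  obtain ⟨N, hN⟩ := SquareSummable.familySeminorm_lt x.2 p (half_pos hε)
  filter_upwards [eventually_ge_atTop N] with n hn
  rw [dist_zero_right, Real.norm_of_nonneg (apply_nonneg _ _), ← modSeminorm_eq]
  refine lt_of_le_of_lt (HilbertSum.modSeminorm_le fun m => ?_) (half_lt_self hε)
  have hcoord : ∀ j, (∑ k ∈ Finset.range n, (HilbertSum.proj k).adj (x.1 k) - x).1 j =
      if j < n then 0 else -x.1 j := by
    intro j
    have h1 : (∑ k ∈ Finset.range n, (HilbertSum.proj k).adj (x.1 k) - x).1 j =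
        ∑ k ∈ Finset.range n, (Pi.single k (x.1 k) : ∀ n, E n) j - x.1 j := by
      have h := map_sub (HilbertSum.proj j).toLin
        (∑ k ∈ Finset.range n, (HilbertSum.proj k).adj (x.1 k)) x
      rw [map_sum] at h
      exact h
    rw [h1]
    split_ifs with hj
    · rw [Finset.sum_eq_single_of_mem j (Finset.mem_range.2 hj), Pi.single_eq_same, sub_self]
      intro k _ hk
      exact Pi.single_eq_of_ne hk.symm _
    · rw [Finset.sum_eq_zero, zero_sub]
      intro k hk
      exact Pi.single_eq_of_ne (by have := Finset.mem_range.1 hk; omega) _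
  have h2 : ∑ j ∈ Finset.range m, inner A
      ((∑ k ∈ Finset.range n, (HilbertSum.proj k).adj (x.1 k) - x).1 j)
      ((∑ k ∈ Finset.range n, (HilbertSum.proj k).adj (x.1 k) - x).1 j) =
      ∑ j ∈ Finset.Ico n m, inner A (x.1 j) (x.1 j) := by
    simp only [hcoord]
    rw [← Finset.sum_subset (s₁ := Finset.Ico n m)]
    · refine Finset.sum_congr rfl fun j hj => ?_
      rw [if_neg (not_lt.2 (Finset.mem_Ico.1 hj).1), HermitianModule.inner_neg_left,
        HermitianModule.inner_neg_right, neg_neg]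
    · intro j hj
      exact Finset.mem_range.2 (Finset.mem_Ico.1 hj).2
    · intro j hj hj'
      rw [Finset.mem_range] at hj
      rw [Finset.mem_Ico, not_and, not_lt] at hj'
      rw [if_pos (by by_contra! h; exact absurd (hj' h) (not_le.2 hj)),
        HermitianModule.inner_zero_right]
  rw [familySeminorm_apply, h2, ← familySeminorm_apply p.2.1]
  rcases le_total n m with hnm | hnm
  · exact (hN n hn m hnm).le
  · rw [Finset.Ico_eq_empty_of_le hnm, familySeminorm_apply, Finset.sum_empty, map_zero,
      Real.sqrt_zero]
    positivity

/-- For `T, S ∈ M(⨁ E_n)` with coordinates `T_k`, `S_k` the series `∑ T_k* S_k` converges strictly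
to `T* S`. -/
theorem strictTendsto_sum_proj (T S : MultiplierModule A (HilbertSum A E)) :
    StrictTendsto (fun n => ∑ k ∈ Finset.range n,
      ((HilbertSum.proj k).comp T).adjoint.comp ((HilbertSum.proj k).comp S)) atTop
      (T.adjoint.comp S) := by
  refine Adjointable.strictTendsto_iff.2 ⟨fun a => ?_, fun a => ?_⟩
  · refine ((HilbertSum.modTendsto_truncation (S.toLin a)).map T.adjoint).congr fun n => ?_
    rw [Adjointable.sum_toLin, map_sum]
    rfl
  · refine ((HilbertSum.modTendsto_truncation (T.toLin a)).map S.adjoint).congr fun n => ?_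
    rw [Adjointable.sum_adj, map_sum]
    rfl

namespace StrictSum

theorem tendsto_sum_inner {t : ∀ n, MultiplierModule A (E n)} {l : MultiplierAlg A}
    (h : StrictTendsto (fun n => ∑ k ∈ Finset.range n, (t k).adjoint.comp (t k)) atTop l) (a : A) :
    Tendsto (fun n => ∑ k ∈ Finset.range n, inner A ((t k).toLin a) ((t k).toLin a)) atTop
      (𝓝 (inner A a (l.toLin a))) := by
  refine ((((Adjointable.strictTendsto_iff.1 h).1 a).inner_right a).congr fun n => ?_).tendsto
  rw [Adjointable.sum_toLin, inner_sum_right]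
  exact Finset.sum_congr rfl fun k _ => ((t k).inner_eq _ _).symm

/-- The finite sums of `⟨t_k a, t_k a⟩` are bounded by a multiple of `p(a)²`. -/
theorem exists_bound (t : StrictSum A E) (p : CStarSeminorms A) :
    ∃ C : ℝ, 0 ≤ C ∧ ∀ (J : Finset ℕ) (a : A),
      familySeminorm p.2.1 J (fun k => (t.1 k).toLin a) ≤ C * modSem A p a := by
  obtain ⟨l, hl⟩ := t.2
  refine ⟨√(Adjointable.opSem p l), Real.sqrt_nonneg _, fun J a => ?_⟩
  refine Real.sqrt_le_iff.2 ⟨by positivity, ?_⟩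
  refine (seminorm_sum_inner_le (tendsto_sum_inner hl a) J p).trans ((inner_le p _ _).trans ?_)
  rw [mul_pow, Real.sq_sqrt (apply_nonneg _ _), sq, mul_left_comm]
  gcongr
  exact Adjointable.le_opSem p l a

theorem squareSummable (t : StrictSum A E) (a : A) :
    SquareSummable A fun k => (t.1 k).toLin a :=
  t.2.elim fun _ hl => ⟨_, tendsto_sum_inner hl a⟩

theorem exists_tendsto_sum_adj (t : StrictSum A E) (x : HilbertSum A E) :
    ∃ l : A, ModTendsto A (fun n => ∑ k ∈ Finset.range n, (t.1 k).adj (x.1 k)) atTop l := by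
  suffices h : ∃ l : A, Tendsto (fun n => ∑ k ∈ Finset.range n, (t.1 k).adj (x.1 k)) atTop (𝓝 l) by
    obtain ⟨l, hl⟩ := h
    exact ⟨l, ModTendsto.of_tendsto hl⟩
  refine tendsto_of_cauchy fun p ε hε => ?_
  obtain ⟨C, hC, hb⟩ := t.exists_bound p
  obtain ⟨N, hN⟩ := SquareSummable.familySeminorm_lt x.2 p (ε := ε / (C + 1)) (by positivity)
  refine ⟨N, fun n hn m hm => ?_⟩
  set w := ∑ k ∈ Finset.Ico n m, (t.1 k).adj (x.1 k) with hw
  have h1 : inner A w w = ∑ k ∈ Finset.Ico n m, inner A ((t.1 k).toLin w) (x.1 k) := by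
    conv_lhs => rw [hw]
    rw [inner_sum_right]
    exact Finset.sum_congr rfl fun k _ => ((t.1 k).inner_eq _ _).symm
  have h2 : modSem A p w ≤ C * familySeminorm p.2.1 (Finset.Ico n m) x.1 := by
    refine modSem_le_of_inner_le p (by positivity) ?_
    rw [h1]
    refine (cauchySchwarz_sqrt p.2.1 _ (fun k => (t.1 k).toLin w) x.1).trans ?_
    rw [mul_right_comm]
    exact mul_le_mul_of_nonneg_right (hb _ _) (Real.sqrt_nonneg _)
  rw [modSem_self] at h2
  have h3 := hN n hn m hm
  rw [lt_div_iff₀ (by positivity)] at h3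
  have h4 := apply_nonneg (familySeminorm (E := E) p.2.1 (Finset.Ico n m)) x.1
  linarith

/-- The sum `∑ t_k* x_k`. -/
noncomputable def adjSum (t : StrictSum A E) (x : HilbertSum A E) : A :=
  (t.exists_tendsto_sum_adj x).choose

theorem modTendsto_adjSum (t : StrictSum A E) (x : HilbertSum A E) :
    ModTendsto A (fun n => ∑ k ∈ Finset.range n, (t.1 k).adj (x.1 k)) atTop (t.adjSum x) :=
  (t.exists_tendsto_sum_adj x).choose_spec

/-- The operator `a ↦ (t_n a)_n` in `M(⨁ E_n)`, with adjoint `(x_n) ↦ ∑ t_n* x_n`. -/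
noncomputable def toMultiplier (t : StrictSum A E) : MultiplierModule A (HilbertSum A E) where
  toLin :=
    { toFun := fun a => ⟨fun k => (t.1 k).toLin a, t.squareSummable a⟩
      map_add' := fun a b => Subtype.ext (funext fun k => map_add _ _ _)
      map_smul' := fun z a => Subtype.ext (funext fun k => map_smul _ _ _) }
  adj :=
    { toFun := t.adjSum
      map_add' := fun x y => (t.modTendsto_adjSum (x + y)).unique
        (((t.modTendsto_adjSum x).add (t.modTendsto_adjSum y)).congr fun n => by
          rw [← Finset.sum_add_distrib]
          exact Finset.sum_congr rfl fun k _ => (map_add _ _ _).symm)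
      map_smul' := fun z x => (t.modTendsto_adjSum (z • x)).unique
        (((t.modTendsto_adjSum x).const_smul z).congr fun n => by
          rw [Finset.smul_sum]
          exact Finset.sum_congr rfl fun k _ => (map_smul _ _ _).symm) }
  map_op_smul a b := Subtype.ext (funext fun k => (t.1 k).map_op_smul a b)
  adj_op_smul a x := (t.modTendsto_adjSum (op a • x)).unique
    (((t.modTendsto_adjSum x).op_smul a).congr fun n => by
      change (∑ k ∈ Finset.range n, (t.1 k).adj (x.1 k)) * a = _
      rw [Finset.sum_mul]
      exact Finset.sum_congr rfl fun k _ => ((t.1 k).adj_op_smul a _).symm)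
  inner_eq a x := by
    refine (ModTendsto.of_tendsto (HilbertSum.inner_tendsto _ x)).unique
      (((t.modTendsto_adjSum x).inner_right a).congr fun n => ?_)
    rw [inner_sum_right]
    exact Finset.sum_congr rfl fun k _ => ((t.1 k).inner_eq _ _).symm

/-- Strictly square summable sequences of multipliers are the coordinate sequences of the elements
of `M(⨁ E_n)`. -/
noncomputable def equivMultiplier : StrictSum A E ≃ MultiplierModule A (HilbertSum A E) where
  toFun := toMultiplier
  invFun T := ⟨fun k => (HilbertSum.proj k).comp T, _, strictTendsto_sum_proj T T⟩
  left_inv _ := Subtype.ext (funext fun _ => Adjointable.ext_toLin fun _ => rfl)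
  right_inv _ := Adjointable.ext_toLin fun _ => rfl

theorem proj_comp_equivMultiplier (t : StrictSum A E) (k : ℕ) :
    (HilbertSum.proj k).comp (equivMultiplier t) = t.1 k :=
  Adjointable.ext_toLin fun _ => rfl

end StrictSum

end strictSum

end LocC

open LocC MulOpposite Filter in
theorem theorem3p9 {A : Type*} [NonUnitalRing A] [StarRing A] [Module ℂ A] [IsScalarTower ℂ A A]
    [SMulCommClass ℂ A A] [StarModule ℂ A] [TopologicalSpace A] [LocallyCStarAlgebra A]
    (E : ℕ → Type*) [∀ n, AddCommGroup (E n)] [∀ n, Module ℂ (E n)] [∀ n, SMul Aᵐᵒᵖ (E n)]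
    [∀ n, Inner A (E n)] [∀ n, IsHilbertModule A (E n)] :
    LocallyCStarAlgebra (MultiplierAlg A) ∧
    ∃ (_ : AddCommGroup (StrictSum A E)) (_ : Module ℂ (StrictSum A E))
      (_ : SMul (MultiplierAlg A)ᵐᵒᵖ (StrictSum A E)) (_ : Inner (MultiplierAlg A) (StrictSum A E)),
      (∀ (t s : StrictSum A E) (n : ℕ), (t + s).1 n = t.1 n + s.1 n) ∧
      (∀ (z : ℂ) (t : StrictSum A E) (n : ℕ), (z • t).1 n = z • t.1 n) ∧
      (∀ (t : StrictSum A E) (b : MultiplierAlg A) (n : ℕ), (op b • t).1 n = op b • t.1 n) ∧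
      (∀ t s : StrictSum A E,
        StrictTendsto (fun n => ∑ k ∈ Finset.range n, (t.1 k).adjoint.comp (s.1 k)) atTop
          (inner (MultiplierAlg A) t s)) ∧
      IsHilbertModule (MultiplierAlg A) (StrictSum A E) ∧
      UnitarilyEquivalent (MultiplierAlg A) (StrictSum A E)
        (MultiplierModule A (HilbertSum A E)) := by
  refine ⟨inferInstance, ?_⟩
  -- All structures are transported along the bijection with `M(⨁ E_n)`.
  let e : StrictSum A E ≃ MultiplierModule A (HilbertSum A E) := StrictSum.equivMultiplier
  let i1 : AddCommGroup (StrictSum A E) := e.addCommGroup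
  let i2 : Module ℂ (StrictSum A E) := e.module ℂ
  let i3 : SMul (MultiplierAlg A)ᵐᵒᵖ (StrictSum A E) := ⟨fun b t => e.symm (b • e t)⟩
  let i4 : Inner (MultiplierAlg A) (StrictSum A E) :=
    ⟨fun t s => inner (MultiplierAlg A) (e t) (e s)⟩
  let e' : StrictSum A E ≃ₗ[ℂ] MultiplierModule A (HilbertSum A E) := e.linearEquiv ℂ
  have hs : ∀ (b : MultiplierAlg A) (t : StrictSum A E), e' (op b • t) = op b • e' t :=
    fun b t => e.apply_symm_apply _
  have hi : ∀ t s : StrictSum A E,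
      inner (MultiplierAlg A) (e' t) (e' s) = inner (MultiplierAlg A) t s := fun _ _ => rfl
  refine ⟨i1, i2, i3, i4, fun t s n => Adjointable.ext_toLin fun _ => rfl,
    fun z t n => Adjointable.ext_toLin fun _ => rfl,
    fun t b n => Adjointable.ext_toLin fun _ => rfl, fun t s => ?_,
    isHilbertModule_of_linearEquiv e' hs hi, unitarilyEquivalent_of_linearEquiv e' hs hi⟩
  have h := strictTendsto_sum_proj (e t) (e s)
  simp only [e, StrictSum.proj_comp_equivMultiplier] at h
  exact h
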